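/- For integers $k\ge 3$, $n\ge k$ and a real $d>0$ let $\boldsymbol\Phi=\boldsymbol\Phi_k(n,\boldsymbol m)$ be the random $k$-SAT formula over Boolean variables $x_1,\dots,x_n$ with $\boldsymbol m$ clauses, where $\boldsymbol m$ is a Poisson variable with mean $dn/k$ and where, given $\boldsymbol m$, the clauses $a_1,\dots,a_{\boldsymbol m}$ are independent, each consisting of an ordered family of $k$ distinct variables chosen uniformly at random together with $k$ independent uniformly random signs $\pm1$. An assignment $\sigma\in\{\pm1\}^{\{x_1,\dots,x_n\}}$ satisfies a clause with variables $y_1,\dots,y_k$ and signs $J_1,\dots,J_k$ if $\max_{j} J_j\sigma_{y_j}=1$. For $\beta>0$ let $$Z(\boldsymbol\Phi,\beta)=\sum_{\sigma\in\{\pm1\}^{\{x_1,\dots,x_n\}}}\exp\Bigl(-\beta\sum_{i=1}^{\boldsymbol m}\mathbb 1\{\sigma\text{ does not satisfy }a_i\}\Bigr),\qquad d^*(k)=k2^k\ln 2-10k^2 .$$ There exists an absolute constant $k_0\ge 3$ such that for all integers $k\ge k_0$, all $\beta\ge 1$ and all $0<d<d^*(k)$ the following holds. The equation $$1-2p-(1-e^{-\beta})(1-p)^k=0$$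 has a unique root $p\in(0,1)$; for every $n\ge k$ the random variable $\log Z(\boldsymbol\Phi,\beta)$ is integrable; and $$\liminf_{n\to\infty}\frac1n\,\mathbb E\bigl[\log Z(\boldsymbol\Phi,\beta)\bigr]\;\ge\;\Bigl(1-\frac{(k-1)d}{k}\Bigr)\log 2-\frac d2\log p-\frac d2\log(1-p)+\frac dk\log p .$$ -/

import Mathlib

open MeasureTheory ProbabilityTheory Filter

namespace RandomSAT

/-- A `k`-clause over the variables `x_1, …, x_n`: an ordered family of `k` distinct variables
together with a sign in `{±1}` (that is, in `ℤˣ`) for each position. -/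
structure Clause (k n : ℕ) where
  /-- The variable at each position. -/
  var : Fin k ↪ Fin n
  /-- The sign with which the variable at each position appears. -/
  sign : Fin k → ℤˣ

/-- A `±1`-assignment satisfies a clause if it makes at least one literal true,
i.e. if the product of sign and value is `1` at some position. -/
def Clause.Sat {k n : ℕ} (a : Clause k n) (σ : Fin n → ℤˣ) : Prop :=
  ∃ j : Fin k, a.sign j * σ (a.var j) = 1

instance {k n : ℕ} (a : Clause k n) (σ : Fin n → ℤˣ) : Decidable (a.Sat σ) :=
  inferInstanceAs (Decidable (∃ j : Fin k, a.sign j * σ (a.var j) = 1))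

/-- Clauses form a finite set; every set of clauses is an event. -/
instance (k n : ℕ) : MeasurableSpace (Clause k n) := ⊤

/-- A `k`-SAT formula over `x_1, …, x_n`: a number `m` and a sequence of `m` clauses. -/
structure Formula (k n : ℕ) where
  /-- The number of clauses. -/
  size : ℕ
  /-- The sequence of clauses. -/
  clause : Fin size → Clause k n

/-- Formulas form a countable set; every set of formulas is an event. -/
instance (k n : ℕ) : MeasurableSpace (Formula k n) := ⊤

/-- The number of clauses of `Φ` that the assignment `σ` fails to satisfy. -/
def Formula.numViolated {k n : ℕ} (Φ : Formula k n) (σ : Fin n → ℤˣ) : ℕ :=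
  ∑ i : Fin Φ.size, if (Φ.clause i).Sat σ then 0 else 1

/-- The partition function `Z(Φ, β)`. -/
noncomputable def Formula.Z {k n : ℕ} (Φ : Formula k n) (β : ℝ) : ℝ :=
  ∑ σ : Fin n → ℤˣ, Real.exp (-β * (Φ.numViolated σ : ℝ))

/-- The law of a random clause: uniform over all clauses, i.e. `k` variables drawn uniformly
without replacement and, independently, `k` independent uniform signs. -/
noncomputable def clauseLaw (k n : ℕ) : Measure (Clause k n) := uniformOn Set.univ

/-- The law of the random formula on `n` variables with average variable degree `d`: the number
`m` of clauses is Poisson with mean `d n / k`; given `m`, the clauses are independent random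
clauses. It is a probability measure when `k ≤ n` (there is no clause when `n < k`). -/
noncomputable def formulaLaw (k n : ℕ) (d : ℝ) : Measure (Formula k n) :=
  (poissonMeasure (d * n / k).toNNReal).bind fun m =>
    (Measure.pi fun _ : Fin m => clauseLaw k n).map (Formula.mk m)

/-- The density bound `d^*(k) = k 2^k ln 2 - 10 k^2`. -/
noncomputable def dStar (k : ℕ) : ℝ := k * 2 ^ k * Real.log 2 - 10 * (k : ℝ) ^ 2

end RandomSAT

/-!
The lower bound is the exponent of a first moment, and it is attained because a second moment
matches it.

Let `p` be the root and `δ = 1 - 2 * p`. Give every literal, on top of the Boltzmann factor of its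
clause, the weight `1 - δ` if it is true and `1 + δ` if it is false (`balancedWeight`). The equation
for `p` says exactly that under the law of a clause tilted in this way every literal is true with
probability one half. Two assignments with normalised inner product `x` then have clause
correlation `overlapFun k δ x = ∑ j, k.choose j * x ^ j * (δ ^ j - δ) ^ 2`, which has no linear
term in `x` and nonnegative coefficients (`pairWeight_balancedWeight`, `overlapFun_le`). Below the
density `2 ^ k * log 2 - 10 * k` of clauses per variable the gain from this correlation stays below
the entropy `log 2 - H ((1 + x) / 2)` lost at overlap `x`, for every `x` (`overlap_exponent_le`).
So the second moment of the tilted partition function is at most `exp (o(n))` times the square of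
the mean (`expect_tiltedZ_sq_le_sq`).

The logarithm of the tilted partition function has bounded differences, hence subgaussian
exponential moments; log-convexity of moments at the exponents `t < 1 < 2` turns the second moment
bound into `𝔼 log Z_tilted ≥ log 𝔼 Z_tilted - o(n)` (`log_expect_le_expect_log`). The tilt is then
removed by convexity: raise the literal weights to the power `s`. The logarithm of the resulting
partition function is convex in `s`, it is `log Z` at `s = 0`, its mean is known up to `o(n)` at
`s = 1`, and it is bounded at `s = 1 + ε` by the logarithm of the mean. As `ε` tends to `0` the
difference quotient of the first-moment exponent at `s = 1` tends to
`k / 2 * (log (1 - δ) + log (1 + δ))` per clause (`hasDerivAt_log_meanWeight`), and what remains is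
the asserted bound (`eventually_le_meanLogZ`).

Adding a clause changes `log Z` by at most `β`, so the fluctuations of the Poisson number of
clauses, of order `√n`, do not matter (`meanLogZ_sub_le_integral_log_Z`).
-/

open scoped BigOperators

namespace RandomSAT

/-! ### Moments and concentration on finite product spaces -/

/-- Hölder's inequality in the form of log-convexity. -/
lemma sum_rpow_mul_rpow_le {ι : Type*} (s : Finset ι) {y z : ι → ℝ} (hy : ∀ i, 0 ≤ y i)
    (hz : ∀ i, 0 ≤ z i) {a b : ℝ} (ha : 0 < a) (hb : 0 < b) (hab : a + b = 1) :
    ∑ i ∈ s, y i ^ a * z i ^ b ≤ (∑ i ∈ s, y i) ^ a * (∑ i ∈ s, z i) ^ b := by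
  have hpq : (1 / a).HolderConjugate (1 / b) := by
    rw [Real.holderConjugate_iff]
    refine ⟨by rw [lt_div_iff₀ ha]; linarith, by simpa using hab⟩
  have h := Real.inner_le_Lp_mul_Lq_of_nonneg s hpq (f := fun i => y i ^ a)
    (g := fun i => z i ^ b) (fun i _ => Real.rpow_nonneg (hy i) _)
    (fun i _ => Real.rpow_nonneg (hz i) _)
  have h1 : ∀ i, (y i ^ a) ^ (1 / a) = y i := fun i => by
    rw [← Real.rpow_mul (hy i), mul_one_div_cancel ha.ne', Real.rpow_one]
  have h2 : ∀ i, (z i ^ b) ^ (1 / b) = z i := fun i => by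
    rw [← Real.rpow_mul (hz i), mul_one_div_cancel hb.ne', Real.rpow_one]
  simpa only [h1, h2, one_div_one_div] using h

lemma log_sum_rpow_mul_rpow_le {ι : Type*} {s : Finset ι} (hs : s.Nonempty) {y z : ι → ℝ}
    (hy : ∀ i, 0 < y i) (hz : ∀ i, 0 < z i) {a b : ℝ} (ha : 0 < a) (hb : 0 < b)
    (hab : a + b = 1) :
    Real.log (∑ i ∈ s, y i ^ a * z i ^ b) ≤
      a * Real.log (∑ i ∈ s, y i) + b * Real.log (∑ i ∈ s, z i) := by
  have hy' := Finset.sum_pos (fun i _ => hy i) hs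
  have hz' := Finset.sum_pos (fun i _ => hz i) hs
  rw [← Real.log_rpow hy', ← Real.log_rpow hz', ← Real.log_mul (by positivity) (by positivity)]
  refine Real.log_le_log (Finset.sum_pos (fun i _ => ?_) hs)
    (sum_rpow_mul_rpow_le s (fun i => (hy i).le) (fun i => (hz i).le) ha hb hab)
  have := hy i
  have := hz i
  positivity

/-- Log-convexity of the moments of a positive random variable, at the exponents `t < 1 < 2`. -/
lemma log_expect_le_of_moments {Ω : Type*} [Fintype Ω] [Nonempty Ω] {X : Ω → ℝ}
    (hX : ∀ w, 0 < X w) {t : ℝ} (ht : t < 1) :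
    (2 - t) * Real.log (𝔼 w, X w) ≤
      (1 - t) * Real.log (𝔼 w, X w ^ 2) + Real.log (𝔼 w, X w ^ t) := by
  have h2t : 0 < 2 - t := by linarith
  have hc : (0 : ℝ) < Fintype.card Ω := by exact_mod_cast Fintype.card_pos
  have h := log_sum_rpow_mul_rpow_le (Finset.univ_nonempty (α := Ω)) (y := fun w => X w ^ 2)
    (z := fun w => X w ^ t) (fun w => pow_pos (hX w) 2) (fun w => Real.rpow_pos_of_pos (hX w) t)
    (a := (1 - t) / (2 - t)) (b := 1 / (2 - t)) (div_pos (by linarith) h2t)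
    (by positivity) (by field_simp; ring)
  have he : ∀ w, (X w ^ 2) ^ ((1 - t) / (2 - t)) * (X w ^ t) ^ (1 / (2 - t)) = X w := fun w => by
    rw [← Real.rpow_natCast, ← Real.rpow_mul (hX w).le, ← Real.rpow_mul (hX w).le,
      ← Real.rpow_add (hX w)]
    have : ((2 : ℕ) : ℝ) * ((1 - t) / (2 - t)) + t * (1 / (2 - t)) = 1 := by
      push_cast; field_simp; ring
    rw [this, Real.rpow_one]
  simp only [he] at h
  have p1 : 0 < ∑ w, X w := Finset.sum_pos (fun w _ => hX w) Finset.univ_nonempty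
  have p2 : 0 < ∑ w, X w ^ 2 := Finset.sum_pos (fun w _ => pow_pos (hX w) 2) Finset.univ_nonempty
  have p3 : 0 < ∑ w, X w ^ t :=
    Finset.sum_pos (fun w _ => Real.rpow_pos_of_pos (hX w) t) Finset.univ_nonempty
  simp only [Fintype.expect_eq_sum_div_card]
  rw [Real.log_div p1.ne' hc.ne', Real.log_div p2.ne' hc.ne', Real.log_div p3.ne' hc.ne']
  have h' := mul_le_mul_of_nonneg_left h h2t.le
  have e1 : (2 - t) * ((1 - t) / (2 - t) * Real.log (∑ w, X w ^ 2) +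
      1 / (2 - t) * Real.log (∑ w, X w ^ t)) =
      (1 - t) * Real.log (∑ w, X w ^ 2) + Real.log (∑ w, X w ^ t) := by
    field_simp
  rw [e1] at h'
  linarith

lemma expect_fin_cons {A : Type*} [Fintype A] {m : ℕ} (f : (Fin (m + 1) → A) → ℝ) :
    𝔼 a, f a = 𝔼 x : A, 𝔼 a : Fin m → A, f (Fin.cons x a) := by
  rw [← Finset.expect_product']
  symm
  exact Fintype.expect_equiv (Fin.consEquiv fun _ => A) _ _ fun _ => rfl

lemma abs_expect_sub_expect_le {A : Type*} [Fintype A] [Nonempty A] {f g : A → ℝ} {c : ℝ}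
    (h : ∀ a, |f a - g a| ≤ c) : |𝔼 a, f a - 𝔼 a, g a| ≤ c := by
  rw [← Finset.expect_sub_distrib]
  refine (Finset.abs_expect_le _ _).trans ?_
  calc 𝔼 a, |f a - g a| ≤ 𝔼 _a : A, c := Finset.expect_le_expect fun a _ => h a
    _ = c := Fintype.expect_const c

/-- A weak form of Hoeffding's lemma for the uniform distribution on a finite set. -/
lemma expect_exp_le_of_range {A : Type*} [Fintype A] [Nonempty A] {g : A → ℝ} {c t : ℝ}
    (hg : ∀ x y, |g x - g y| ≤ c) (ht : 0 ≤ t) (htc : t * c ≤ 1) :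
    𝔼 x, Real.exp (t * g x) ≤ Real.exp (t * 𝔼 x, g x + t ^ 2 * c ^ 2) := by
  set μ := 𝔼 x, g x with hμ
  have hdev : ∀ x, |g x - μ| ≤ c := fun x => by
    have : g x - μ = 𝔼 _y : A, g x - 𝔼 y, g y := by rw [Fintype.expect_const]
    rw [this]
    exact abs_expect_sub_expect_le fun y => hg x y
  have hpt : ∀ x, Real.exp (t * g x) ≤
      Real.exp (t * μ) * (1 + t * (g x - μ) + t ^ 2 * c ^ 2) := fun x => by
    have habs : |t * (g x - μ)| ≤ t * c := by
      rw [abs_mul, abs_of_nonneg ht]; exact mul_le_mul_of_nonneg_left (hdev x) ht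
    have h1 := (abs_le.1 (Real.abs_exp_sub_one_sub_id_le (habs.trans htc))).2
    have h2 : (t * (g x - μ)) ^ 2 ≤ (t * c) ^ 2 := sq_le_sq' (abs_le.1 habs).1 (abs_le.1 habs).2
    have : t * g x = t * μ + t * (g x - μ) := by ring
    rw [this, Real.exp_add]
    refine mul_le_mul_of_nonneg_left ?_ (Real.exp_pos _).le
    nlinarith
  calc 𝔼 x, Real.exp (t * g x)
      ≤ 𝔼 x, Real.exp (t * μ) * (1 + t * (g x - μ) + t ^ 2 * c ^ 2) :=
        Finset.expect_le_expect fun x _ => hpt x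
    _ = Real.exp (t * μ) * (1 + t ^ 2 * c ^ 2) := by
        rw [← Finset.mul_expect, Finset.expect_add_distrib, Finset.expect_add_distrib,
          ← Finset.mul_expect, Finset.expect_sub_distrib, Fintype.expect_const,
          Fintype.expect_const, Fintype.expect_const, ← hμ]
        ring
    _ ≤ Real.exp (t * μ) * Real.exp (t ^ 2 * c ^ 2) := by
        gcongr
        linarith [Real.add_one_le_exp (t ^ 2 * c ^ 2)]
    _ = _ := (Real.exp_add _ _).symm

/-- The bounded-differences inequality, for moment generating functions. -/
lemma expect_exp_le_of_bounded_differences {A : Type*} [Fintype A] [Nonempty A] {c t : ℝ}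
    (ht : 0 ≤ t) (htc : t * c ≤ 1) : ∀ {m : ℕ} (f : (Fin m → A) → ℝ),
    (∀ a b i, (∀ j, j ≠ i → a j = b j) → |f a - f b| ≤ c) →
    𝔼 a, Real.exp (t * f a) ≤ Real.exp (t * 𝔼 a, f a + m * (t ^ 2 * c ^ 2))
  | 0, f, _ => by
    have h : ∀ a : Fin 0 → A, f a = f default := fun a => by rw [Subsingleton.elim a default]
    simp only [h]
    simp
  | m + 1, f, hf => by
    rw [expect_fin_cons, expect_fin_cons (fun a => f a)]
    have ih : ∀ x, 𝔼 a : Fin m → A, Real.exp (t * f (Fin.cons x a)) ≤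
        Real.exp (t * 𝔼 a : Fin m → A, f (Fin.cons x a)) * Real.exp (m * (t ^ 2 * c ^ 2)) := by
      intro x
      rw [← Real.exp_add]
      refine expect_exp_le_of_bounded_differences ht htc (fun a => f (Fin.cons x a)) ?_
      intro a b i h
      refine hf _ _ i.succ fun j => ?_
      refine Fin.cases (fun _ => rfl) (fun j hj => ?_) j
      simpa using h j fun e => hj (by rw [e])
    calc _ ≤ 𝔼 x, Real.exp (t * 𝔼 a : Fin m → A, f (Fin.cons x a)) *
            Real.exp (m * (t ^ 2 * c ^ 2)) := Finset.expect_le_expect fun x _ => ih x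
      _ = (𝔼 x, Real.exp (t * 𝔼 a : Fin m → A, f (Fin.cons x a))) *
            Real.exp (m * (t ^ 2 * c ^ 2)) := by rw [Finset.expect_mul]
      _ ≤ Real.exp (t * (𝔼 x, 𝔼 a : Fin m → A, f (Fin.cons x a)) + t ^ 2 * c ^ 2) *
            Real.exp (m * (t ^ 2 * c ^ 2)) := by
          gcongr
          refine expect_exp_le_of_range (fun x y => ?_) ht htc
          refine abs_expect_sub_expect_le fun a => hf _ _ 0 fun j => ?_
          refine Fin.cases (fun h => absurd rfl h) (fun j _ => ?_) j
          simp
      _ = _ := by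
          rw [← Real.exp_add]
          push_cast
          ring_nf

/-- If the second moment of a positive function on a product space is at most `K` times the
square of its mean, and its logarithm has bounded differences, then the mean of the logarithm
almost reaches the logarithm of the mean. -/
lemma log_expect_le_expect_log {A : Type*} [Fintype A] [Nonempty A] {m : ℕ}
    {X : (Fin m → A) → ℝ} (hX : ∀ a, 0 < X a) {c t K : ℝ} (ht : 0 < t) (ht1 : t < 1)
    (htc : t * c ≤ 1) (hK : 1 ≤ K)
    (hc : ∀ a b i, (∀ j, j ≠ i → a j = b j) → |Real.log (X a) - Real.log (X b)| ≤ c)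
    (h2 : 𝔼 a, X a ^ 2 ≤ K * (𝔼 a, X a) ^ 2) :
    Real.log (𝔼 a, X a) ≤ 𝔼 a, Real.log (X a) + t * m * c ^ 2 + Real.log K / t := by
  have hE : 0 < 𝔼 a, X a := Finset.expect_pos (fun a _ => hX a) Finset.univ_nonempty
  have hE2 : 0 < 𝔼 a, X a ^ 2 :=
    Finset.expect_pos (fun a _ => pow_pos (hX a) 2) Finset.univ_nonempty
  have hEt : 0 < 𝔼 a, X a ^ t :=
    Finset.expect_pos (fun a _ => Real.rpow_pos_of_pos (hX a) t) Finset.univ_nonempty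
  have h := log_expect_le_of_moments hX ht1
  have hs : Real.log (𝔼 a, X a ^ 2) ≤ Real.log K + 2 * Real.log (𝔼 a, X a) := by
    refine (Real.log_le_log hE2 h2).trans ?_
    rw [Real.log_mul (by positivity) (by positivity), Real.log_pow]
    push_cast; rfl
  have hm : Real.log (𝔼 a, X a ^ t) ≤ t * 𝔼 a, Real.log (X a) + m * (t ^ 2 * c ^ 2) := by
    rw [Real.log_le_iff_le_exp hEt]
    refine le_trans (le_of_eq ?_) (expect_exp_le_of_bounded_differences ht.le htc _ hc)
    refine Finset.expect_congr rfl fun a _ => ?_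
    rw [Real.rpow_def_of_pos (hX a), mul_comm]
  have hlK : 0 ≤ Real.log K := Real.log_nonneg hK
  have hs' := mul_le_mul_of_nonneg_left hs (by linarith : 0 ≤ 1 - t)
  have hfin : t * Real.log (𝔼 a, X a) ≤
      t * (𝔼 a, Real.log (X a) + t * m * c ^ 2 + Real.log K / t) := by
    have : t * (𝔼 a, Real.log (X a) + t * m * c ^ 2 + Real.log K / t) =
      t * 𝔼 a, Real.log (X a) + m * (t ^ 2 * c ^ 2) + Real.log K := by field_simp
    rw [this]
    nlinarith
  exact le_of_mul_le_mul_left hfin ht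

/-! ### Averages over a random clause -/

/-- A clause is a pair of an embedding and a sign vector. -/
def clauseEquiv (k n : ℕ) : Clause k n ≃ (Fin k ↪ Fin n) × (Fin k → ℤˣ) where
  toFun a := (a.var, a.sign)
  invFun x := ⟨x.1, x.2⟩
  left_inv _ := rfl
  right_inv _ := rfl

noncomputable instance (k n : ℕ) : Fintype (Clause k n) := Fintype.ofEquiv _ (clauseEquiv k n).symm

lemma nonempty_embedding {k n : ℕ} (h : k ≤ n) : Nonempty (Fin k ↪ Fin n) := ⟨Fin.castLEEmb h⟩

lemma nonempty_clause {k n : ℕ} (h : k ≤ n) : Nonempty (Clause k n) :=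
  ⟨⟨Fin.castLEEmb h, 1⟩⟩

/-- The truth values that an assignment gives to the literals of a clause, `1` meaning true. -/
def Clause.lit {k n : ℕ} (a : Clause k n) (σ : Fin n → ℤˣ) : Fin k → ℤˣ :=
  fun j => a.sign j * σ (a.var j)

/-- The Boltzmann factor of a clause with truth values `τ`, times a weight `ω` for each literal. -/
noncomputable def clauseWeight {k : ℕ} (β : ℝ) (ω : ℤˣ → ℝ) (τ : Fin k → ℤˣ) : ℝ :=
  (if ∃ j, τ j = 1 then 1 else Real.exp (-β)) * ∏ j, ω (τ j)

/-- The partition function in which every literal carries, on top of the Boltzmann factor of its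
clause, the weight `ω` of its truth value. -/
noncomputable def tiltedZ {k n m : ℕ} (β : ℝ) (ω : ℤˣ → ℝ) (Φ : Fin m → Clause k n) : ℝ :=
  ∑ σ : Fin n → ℤˣ, ∏ i, clauseWeight β ω ((Φ i).lit σ)

lemma clauseWeight_pos {k : ℕ} (β : ℝ) {ω : ℤˣ → ℝ} (hω : ∀ s, 0 < ω s) (τ : Fin k → ℤˣ) :
    0 < clauseWeight β ω τ := by
  refine mul_pos ?_ (Finset.prod_pos fun j _ => hω _)
  split_ifs
  · exact one_pos
  · exact Real.exp_pos _

lemma tiltedZ_pos {k n m : ℕ} (β : ℝ) {ω : ℤˣ → ℝ} (hω : ∀ s, 0 < ω s)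
    (Φ : Fin m → Clause k n) : 0 < tiltedZ β ω Φ :=
  Finset.sum_pos (fun _ _ => Finset.prod_pos fun _ _ => clauseWeight_pos β hω _)
    Finset.univ_nonempty

lemma Formula.Z_eq_tiltedZ {k n : ℕ} (Φ : Formula k n) (β : ℝ) :
    Φ.Z β = tiltedZ β (fun _ => 1) Φ.clause := by
  unfold Formula.Z tiltedZ
  refine Finset.sum_congr rfl fun σ _ => ?_
  rw [Formula.numViolated, Nat.cast_sum, Finset.mul_sum, Real.exp_sum]
  refine Finset.prod_congr rfl fun i _ => ?_
  by_cases h : (Φ.clause i).Sat σ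
  · have h' : ∃ j, (Φ.clause i).lit σ j = 1 := h
    simp [clauseWeight, h, h']
  · have h' : ¬∃ j, (Φ.clause i).lit σ j = 1 := h
    simp only [clauseWeight, if_neg h, if_neg h']
    simp

lemma sum_intUnits {M : Type*} [AddCommMonoid M] (f : ℤˣ → M) : ∑ s, f s = f 1 + f (-1) := by
  rw [UnitsInt.univ, Finset.sum_pair (by decide)]

lemma expect_prod_signs {k : ℕ} (f : Fin k → ℤˣ → ℝ) :
    𝔼 τ : Fin k → ℤˣ, ∏ j, f j (τ j) = ∏ j, ((f j 1 + f j (-1)) / 2) := by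
  rw [Fintype.expect_eq_sum_div_card, ← Fintype.prod_sum, Finset.prod_div_distrib]
  simp

lemma clauseWeight_eq {k : ℕ} (β : ℝ) (ω : ℤˣ → ℝ) (τ : Fin k → ℤˣ) :
    clauseWeight β ω τ =
      ∏ j, ω (τ j) - (1 - Real.exp (-β)) * ∏ j, (if τ j = 1 then 0 else ω (τ j)) := by
  unfold clauseWeight
  split_ifs with h
  · obtain ⟨j, hj⟩ := h
    rw [Finset.prod_eq_zero (Finset.mem_univ j) (f := fun j => if τ j = 1 then 0 else ω (τ j))
      (by simp [hj])]
    ring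
  · have : ∏ j, (if τ j = 1 then 0 else ω (τ j)) = ∏ j, ω (τ j) :=
      Finset.prod_congr rfl fun j _ => if_neg fun e => h ⟨j, e⟩
    rw [this]
    ring

lemma expect_clauseWeight (k : ℕ) (β : ℝ) (ω : ℤˣ → ℝ) :
    𝔼 τ : Fin k → ℤˣ, clauseWeight β ω τ =
      ((ω 1 + ω (-1)) / 2) ^ k - (1 - Real.exp (-β)) * (ω (-1) / 2) ^ k := by
  simp only [clauseWeight_eq]
  rw [Finset.expect_sub_distrib, ← Finset.mul_expect, expect_prod_signs (fun _ s => ω s),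
    expect_prod_signs (fun _ s => if s = 1 then 0 else ω s)]
  simp [div_pow]

/-- For a fixed assignment the truth values of the literals of a random clause are uniform and
independent of the variables that occur in it. -/
lemma expect_clause {k n : ℕ} (σ : Fin n → ℤˣ)
    (g : (Fin k ↪ Fin n) → (Fin k → ℤˣ) → ℝ) :
    𝔼 a : Clause k n, g a.var (a.lit σ) = 𝔼 v : Fin k ↪ Fin n, 𝔼 τ : Fin k → ℤˣ, g v τ := by
  have h1 : 𝔼 a : Clause k n, g a.var (a.lit σ) =
      𝔼 x : (Fin k ↪ Fin n) × (Fin k → ℤˣ), g x.1 (fun j => x.2 j * σ (x.1 j)) :=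
    Fintype.expect_equiv (clauseEquiv k n) _ _ fun _ => rfl
  rw [h1, ← Finset.univ_product_univ, Finset.expect_product]
  refine Finset.expect_congr rfl fun v _ => ?_
  exact Fintype.expect_equiv (Equiv.mulRight fun j => σ (v j)) _ _ fun _ => rfl

lemma expect_prod_clauses {A : Type*} [Fintype A] (m : ℕ) (g : A → ℝ) :
    𝔼 Φ : Fin m → A, ∏ i, g (Φ i) = (𝔼 a, g a) ^ m := by
  rw [Fintype.expect_eq_sum_div_card, Fintype.expect_eq_sum_div_card, div_pow, Fintype.sum_pow]
  simp

lemma expect_tiltedZ {k n : ℕ} (h : k ≤ n) (m : ℕ) (β : ℝ) (ω : ℤˣ → ℝ) :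
    𝔼 Φ : Fin m → Clause k n, tiltedZ β ω Φ =
      2 ^ n * (𝔼 τ : Fin k → ℤˣ, clauseWeight β ω τ) ^ m := by
  have := nonempty_embedding h
  unfold tiltedZ
  rw [Finset.expect_sum_comm]
  have : ∀ σ : Fin n → ℤˣ, 𝔼 Φ : Fin m → Clause k n, ∏ i, clauseWeight β ω ((Φ i).lit σ) =
      (𝔼 τ : Fin k → ℤˣ, clauseWeight β ω τ) ^ m := fun σ => by
    rw [expect_prod_clauses m fun a : Clause k n => clauseWeight β ω (a.lit σ),
      expect_clause σ fun _ τ => clauseWeight β ω τ, Fintype.expect_const]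
  simp [this]

/-! ### The second moment -/

/-- The correlation of the clause weights of two assignments whose truth values on the literals
of the clause differ by the sign vector `ρ`. -/
noncomputable def pairWeight {k : ℕ} (β : ℝ) (ω : ℤˣ → ℝ) (ρ : Fin k → ℤˣ) : ℝ :=
  𝔼 τ : Fin k → ℤˣ, clauseWeight β ω τ * clauseWeight β ω (τ * ρ)

lemma pairWeight_nonneg {k : ℕ} (β : ℝ) {ω : ℤˣ → ℝ} (hω : ∀ s, 0 < ω s) (ρ : Fin k → ℤˣ) :
    0 ≤ pairWeight β ω ρ :=
  Finset.expect_nonneg fun _ _ =>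
    mul_nonneg (clauseWeight_pos β hω _).le (clauseWeight_pos β hω _).le

/-- The literal weights `2 * p = 1 - δ` for a true and `2 * (1 - p) = 1 + δ` for a false literal.
When `δ` solves the balance equation, literals of the tilted clause are true with probability one
half. -/
noncomputable def balancedWeight (δ : ℝ) (s : ℤˣ) : ℝ := if s = 1 then 1 - δ else 1 + δ

lemma balancedWeight_pos {δ : ℝ} (h0 : 0 ≤ δ) (h1 : δ < 1) (s : ℤˣ) : 0 < balancedWeight δ s := by
  unfold balancedWeight; split_ifs <;> linarith

/-- The equation for `δ` enters where a product of `k` factors `(1 + δ) / 2`, multiplied by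
`1 - exp (-β)`, is replaced by `δ`. -/
lemma pairWeight_balancedWeight {k : ℕ} {β δ : ℝ}
    (hδ : δ = (1 - Real.exp (-β)) * ((1 + δ) / 2) ^ k) (ρ : Fin k → ℤˣ) :
    pairWeight β (balancedWeight δ) ρ =
      ∏ j, (1 + ((ρ j : ℤ) : ℝ) * δ ^ 2) - 2 * δ * ∏ j, (1 + ((ρ j : ℤ) : ℝ) * δ) +
        δ ^ 2 * ∏ j, (1 + ((ρ j : ℤ) : ℝ)) := by
  set c := 1 - Real.exp (-β) with hc
  set ω := balancedWeight δ with hω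
  have w1 : ω 1 = 1 - δ := by simp [hω, balancedWeight]
  have w2 : ω (-1) = 1 + δ := by
    rw [hω, balancedWeight, if_neg (by decide)]
  set ω' : ℤˣ → ℝ := fun s => if s = 1 then 0 else ω s with hω'
  have w1' : ω' 1 = 0 := by simp [hω']
  have w2' : ω' (-1) = 1 + δ := by
    simp only [hω']; rw [if_neg (by decide), w2]
  have hexp : ∀ τ : Fin k → ℤˣ, clauseWeight β ω τ * clauseWeight β ω (τ * ρ) =
      ∏ j, (ω (τ j) * ω (τ j * ρ j)) - c * ∏ j, (ω (τ j) * ω' (τ j * ρ j)) -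
        c * ∏ j, (ω' (τ j) * ω (τ j * ρ j)) + c ^ 2 * ∏ j, (ω' (τ j) * ω' (τ j * ρ j)) := by
    intro τ
    rw [clauseWeight_eq, clauseWeight_eq]
    simp only [Finset.prod_mul_distrib, Pi.mul_apply]
    ring
  have hc' : ∀ (y : ℝ) (r : ℤˣ → ℝ), (∀ s, r s = (1 + δ) / 2 * (1 + ((s : ℤ) : ℝ) * y)) →
      c * ∏ j, r (ρ j) = δ * ∏ j, (1 + ((ρ j : ℤ) : ℝ) * y) := by
    intro y r hr
    simp only [hr, Finset.prod_mul_distrib, Finset.prod_const, Finset.card_univ, Fintype.card_fin]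
    rw [← mul_assoc, ← hδ]
  unfold pairWeight
  simp only [hexp]
  rw [Finset.expect_add_distrib, Finset.expect_sub_distrib, Finset.expect_sub_distrib,
    ← Finset.mul_expect, ← Finset.mul_expect, ← Finset.mul_expect,
    expect_prod_signs (fun j s => ω s * ω (s * ρ j)),
    expect_prod_signs (fun j s => ω s * ω' (s * ρ j)),
    expect_prod_signs (fun j s => ω' s * ω (s * ρ j)),
    expect_prod_signs (fun j s => ω' s * ω' (s * ρ j))]
  have e1 : ∏ j, ((ω 1 * ω (1 * ρ j) + ω (-1) * ω (-1 * ρ j)) / 2) =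
      ∏ j, (1 + ((ρ j : ℤ) : ℝ) * δ ^ 2) := by
    refine Finset.prod_congr rfl fun j _ => ?_
    rcases Int.units_eq_one_or (ρ j) with h | h <;> simp [h, w1, w2] <;> ring
  have e2 : c * ∏ j, ((ω 1 * ω' (1 * ρ j) + ω (-1) * ω' (-1 * ρ j)) / 2) =
      δ * ∏ j, (1 + ((ρ j : ℤ) : ℝ) * δ) := by
    refine hc' δ (fun s => (ω 1 * ω' (1 * s) + ω (-1) * ω' (-1 * s)) / 2) fun s => ?_
    rcases Int.units_eq_one_or s with h | h <;> simp [h, w1, w2, w1', w2'] <;> ring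
  have e3 : c * ∏ j, ((ω' 1 * ω (1 * ρ j) + ω' (-1) * ω (-1 * ρ j)) / 2) =
      δ * ∏ j, (1 + ((ρ j : ℤ) : ℝ) * δ) := by
    refine hc' δ (fun s => (ω' 1 * ω (1 * s) + ω' (-1) * ω (-1 * s)) / 2) fun s => ?_
    rcases Int.units_eq_one_or s with h | h <;> simp [h, w1, w2, w1', w2'] <;> ring
  have e4 : c ^ 2 * ∏ j, ((ω' 1 * ω' (1 * ρ j) + ω' (-1) * ω' (-1 * ρ j)) / 2) =
      δ ^ 2 * ∏ j, (1 + ((ρ j : ℤ) : ℝ)) := by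
    have : ∀ j, (ω' 1 * ω' (1 * ρ j) + ω' (-1) * ω' (-1 * ρ j)) / 2 =
        ((1 + δ) / 2) ^ 2 * (1 + ((ρ j : ℤ) : ℝ)) := fun j => by
      rcases Int.units_eq_one_or (ρ j) with h | h <;> simp [h, w1', w2'] <;> ring
    simp only [this, Finset.prod_mul_distrib, Finset.prod_const, Finset.card_univ,
      Fintype.card_fin]
    rw [← mul_assoc, ← pow_mul, mul_comm 2 k, pow_mul, ← mul_pow, ← hδ]
  rw [e1, e2, e3, e4]
  ring

/-- The clause correlation of two assignments with normalised inner product `x`, for clauses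
whose variables are drawn with replacement. -/
noncomputable def overlapFun (k : ℕ) (δ x : ℝ) : ℝ :=
  (1 + x * δ ^ 2) ^ k - 2 * δ * (1 + x * δ) ^ k + δ ^ 2 * (1 + x) ^ k

/-- The mean of the entries of a sign vector. -/
noncomputable def signMean {n : ℕ} (ρ : Fin n → ℤˣ) : ℝ := 𝔼 i, ((ρ i : ℤ) : ℝ)

lemma expect_pairWeight {k n : ℕ} [NeZero n] {β δ : ℝ}
    (hδ : δ = (1 - Real.exp (-β)) * ((1 + δ) / 2) ^ k) (ρ : Fin n → ℤˣ) :
    𝔼 v : Fin k → Fin n, pairWeight β (balancedWeight δ) (fun j => ρ (v j)) =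
      overlapFun k δ (signMean ρ) := by
  have key : ∀ y : ℝ, 𝔼 v : Fin k → Fin n, ∏ j, (1 + ((ρ (v j) : ℤ) : ℝ) * y) =
      (1 + signMean ρ * y) ^ k := fun y => by
    rw [expect_prod_clauses k fun i : Fin n => 1 + ((ρ i : ℤ) : ℝ) * y,
      Finset.expect_add_distrib, Fintype.expect_const, ← Finset.expect_mul, signMean]
  have key1 := key 1
  simp only [mul_one] at key1
  simp only [pairWeight_balancedWeight hδ]
  rw [Finset.expect_add_distrib, Finset.expect_sub_distrib, ← Finset.mul_expect,
    ← Finset.mul_expect, key, key, key1, overlapFun]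

/-- Drawing the variables of a clause without replacement costs at most the factor
`n ^ k / n.descFactorial k`. -/
lemma expect_embedding_le {k n : ℕ} (h : k ≤ n) (F : (Fin k → Fin n) → ℝ) (hF : ∀ v, 0 ≤ F v) :
    𝔼 v : Fin k ↪ Fin n, F v ≤ (n : ℝ) ^ k / (n.descFactorial k : ℝ) * 𝔼 v, F v := by
  rw [Fintype.expect_eq_sum_div_card, Fintype.expect_eq_sum_div_card]
  have h1 : ∑ v : Fin k ↪ Fin n, F v ≤ ∑ v, F v := by
    rw [← Finset.sum_image (s := Finset.univ) (g := fun v : Fin k ↪ Fin n => (v : Fin k → Fin n))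
      (f := F) (fun a _ b _ e => DFunLike.coe_injective e)]
    exact Finset.sum_le_sum_of_subset_of_nonneg (Finset.subset_univ _) fun v _ _ => hF v
  have h2 : (0 : ℝ) < n.descFactorial k := by
    exact_mod_cast Nat.pos_of_ne_zero (by rw [Ne, Nat.descFactorial_eq_zero_iff_lt]; omega)
  have h3 : (n : ℝ) ^ k ≠ 0 := by
    rcases Nat.eq_zero_or_pos n with rfl | hn
    · obtain rfl : k = 0 := by omega
      simp
    · positivity
  simp only [Fintype.card_embedding_eq, Fintype.card_pi, Fintype.card_fin, Finset.prod_const,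
    Finset.card_univ, Nat.cast_pow]
  calc _ ≤ (∑ v, F v) / (n.descFactorial k : ℝ) := by gcongr
    _ = _ := by field_simp

lemma expect_clauseWeight_mul_le {k n : ℕ} [NeZero n] (h : k ≤ n) {β δ : ℝ}
    (hδ : δ = (1 - Real.exp (-β)) * ((1 + δ) / 2) ^ k) (h0 : 0 ≤ δ) (h1 : δ < 1)
    (σ ρ : Fin n → ℤˣ) :
    𝔼 a : Clause k n, clauseWeight β (balancedWeight δ) (a.lit σ) *
        clauseWeight β (balancedWeight δ) (a.lit (σ * ρ)) ≤
      (n : ℝ) ^ k / (n.descFactorial k : ℝ) * overlapFun k δ (signMean ρ) := by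
  have hω := balancedWeight_pos h0 h1
  have hlit : ∀ a : Clause k n, a.lit (σ * ρ) = a.lit σ * fun j => ρ (a.var j) := fun a => by
    ext j; simp [Clause.lit, mul_assoc]
  simp only [hlit]
  rw [expect_clause σ fun v τ => clauseWeight β (balancedWeight δ) τ *
    clauseWeight β (balancedWeight δ) (τ * fun j => ρ (v j)), ← expect_pairWeight hδ]
  exact expect_embedding_le h (fun v => pairWeight β (balancedWeight δ) fun j => ρ (v j))
    fun v => pairWeight_nonneg β hω _

lemma expect_tiltedZ_sq_le {k n : ℕ} [NeZero n] (h : k ≤ n) (m : ℕ) {β δ : ℝ}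
    (hδ : δ = (1 - Real.exp (-β)) * ((1 + δ) / 2) ^ k) (h0 : 0 ≤ δ) (h1 : δ < 1) :
    𝔼 Φ : Fin m → Clause k n, tiltedZ β (balancedWeight δ) Φ ^ 2 ≤
      2 ^ n * ((n : ℝ) ^ k / (n.descFactorial k : ℝ)) ^ m *
        ∑ ρ : Fin n → ℤˣ, overlapFun k δ (signMean ρ) ^ m := by
  have hω := balancedWeight_pos h0 h1
  have hsq : ∀ Φ : Fin m → Clause k n, tiltedZ β (balancedWeight δ) Φ ^ 2 =
      ∑ σ, ∑ ρ, ∏ i, (clauseWeight β (balancedWeight δ) ((Φ i).lit σ) *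
        clauseWeight β (balancedWeight δ) ((Φ i).lit (σ * ρ))) := by
    intro Φ
    rw [tiltedZ, sq, Finset.sum_mul]
    refine Finset.sum_congr rfl fun σ _ => ?_
    rw [Finset.mul_sum]
    simp only [Finset.prod_mul_distrib]
    exact (Fintype.sum_equiv (Equiv.mulLeft σ) _ _ fun ρ => rfl).symm
  simp only [hsq]
  rw [Finset.expect_sum_comm]
  have hterm : ∀ σ ρ : Fin n → ℤˣ, 𝔼 Φ : Fin m → Clause k n,
      ∏ i, (clauseWeight β (balancedWeight δ) ((Φ i).lit σ) *
        clauseWeight β (balancedWeight δ) ((Φ i).lit (σ * ρ))) ≤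
      ((n : ℝ) ^ k / (n.descFactorial k : ℝ)) ^ m * overlapFun k δ (signMean ρ) ^ m := by
    intro σ ρ
    rw [expect_prod_clauses m fun a : Clause k n => clauseWeight β (balancedWeight δ) (a.lit σ) *
        clauseWeight β (balancedWeight δ) (a.lit (σ * ρ)), ← mul_pow]
    refine pow_le_pow_left₀ (Finset.expect_nonneg fun _ _ =>
      mul_nonneg (clauseWeight_pos β hω _).le (clauseWeight_pos β hω _).le) ?_ m
    exact expect_clauseWeight_mul_le h hδ h0 h1 σ ρ
  calc _ ≤ ∑ σ : Fin n → ℤˣ, ∑ ρ : Fin n → ℤˣ,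
        ((n : ℝ) ^ k / (n.descFactorial k : ℝ)) ^ m * overlapFun k δ (signMean ρ) ^ m := by
        refine Finset.sum_le_sum fun σ _ => ?_
        rw [Finset.expect_sum_comm]
        exact Finset.sum_le_sum fun ρ _ => hterm σ ρ
    _ = _ := by
        rw [← Finset.mul_sum]
        simp [mul_assoc]

/-! ### Bounded differences of the log-partition function -/

lemma abs_log_tiltedZ_sub_le {k n m : ℕ} {β : ℝ} {ω : ℤˣ → ℝ} (hω : ∀ s, 0 < ω s) {c : ℝ}
    (hc : ∀ τ τ' : Fin k → ℤˣ, clauseWeight β ω τ ≤ Real.exp c * clauseWeight β ω τ')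
    (Φ Ψ : Fin m → Clause k n) (i : Fin m) (h : ∀ j, j ≠ i → Φ j = Ψ j) :
    |Real.log (tiltedZ β ω Φ) - Real.log (tiltedZ β ω Ψ)| ≤ c := by
  have key : ∀ Φ Ψ : Fin m → Clause k n, (∀ j, j ≠ i → Φ j = Ψ j) →
      Real.log (tiltedZ β ω Φ) ≤ c + Real.log (tiltedZ β ω Ψ) := by
    intro Φ Ψ h
    rw [← Real.log_exp c, ← Real.log_mul (Real.exp_pos _).ne' (tiltedZ_pos β hω _).ne']
    refine Real.log_le_log (tiltedZ_pos β hω _) ?_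
    rw [tiltedZ, tiltedZ, Finset.mul_sum]
    refine Finset.sum_le_sum fun σ _ => ?_
    rw [← Finset.mul_prod_erase _ _ (Finset.mem_univ i),
      ← Finset.mul_prod_erase (a := i) _ _ (Finset.mem_univ i), ← mul_assoc]
    have : ∏ j ∈ Finset.univ.erase i, clauseWeight β ω ((Φ j).lit σ) =
        ∏ j ∈ Finset.univ.erase i, clauseWeight β ω ((Ψ j).lit σ) :=
      Finset.prod_congr rfl fun j hj => by rw [h j (Finset.ne_of_mem_erase hj)]
    rw [this]
    exact mul_le_mul_of_nonneg_right (hc _ _)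
      (Finset.prod_nonneg fun _ _ => (clauseWeight_pos β hω _).le)
  rw [abs_le]
  constructor
  · linarith [key Ψ Φ fun j hj => (h j hj).symm]
  · linarith [key Φ Ψ h]

lemma exists_clauseWeight_le (k : ℕ) (β : ℝ) {ω : ℤˣ → ℝ} (hω : ∀ s, 0 < ω s) :
    ∃ c : ℝ, 0 < c ∧ ∀ τ τ' : Fin k → ℤˣ,
      clauseWeight β ω τ ≤ Real.exp c * clauseWeight β ω τ' := by
  have hpos : ∀ τ τ' : Fin k → ℤˣ, 0 < clauseWeight β ω τ / clauseWeight β ω τ' := fun τ τ' =>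
    div_pos (clauseWeight_pos β hω τ) (clauseWeight_pos β hω τ')
  refine ⟨∑ x : (Fin k → ℤˣ) × (Fin k → ℤˣ), clauseWeight β ω x.1 / clauseWeight β ω x.2,
    Finset.sum_pos (fun x _ => hpos _ _) Finset.univ_nonempty, fun τ τ' => ?_⟩
  rw [← div_le_iff₀ (clauseWeight_pos β hω τ')]
  have h1 := Finset.single_le_sum (f := fun x : (Fin k → ℤˣ) × (Fin k → ℤˣ) =>
    clauseWeight β ω x.1 / clauseWeight β ω x.2) (fun x _ => (hpos _ _).le)
    (Finset.mem_univ (τ, τ'))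
  exact h1.trans ((le_add_of_nonneg_right zero_le_one).trans (Real.add_one_le_exp _))

/-! ### Counting sign vectors by their mean -/

lemma pow_mul_pow_eq_exp_binEntropy {n z : ℕ} (hn : 0 < n) (hz : z ≤ n) :
    ((z : ℝ) / n) ^ z * (1 - (z : ℝ) / n) ^ (n - z) =
      Real.exp (-(n * Real.binEntropy ((z : ℝ) / n))) := by
  have hn' : (0 : ℝ) < n := by exact_mod_cast hn
  rcases Nat.eq_zero_or_pos z with rfl | hz0
  · simp
  rcases hz.eq_or_lt with rfl | hlt
  · simp [hn'.ne']
  have h1 : 0 < (z : ℝ) / n := by positivity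
  have h2 : 0 < 1 - (z : ℝ) / n := by
    rw [sub_pos, div_lt_one hn']
    exact_mod_cast hlt
  rw [← Real.exp_log (pow_pos h1 z), ← Real.exp_log (pow_pos h2 (n - z)), ← Real.exp_add,
    Real.log_pow, Real.log_pow, Nat.cast_sub hz, Real.binEntropy, Real.log_inv, Real.log_inv]
  congr 1
  field_simp
  ring

/-- A sign vector with mean `x` has probability `exp (-n * H ((1 + x) / 2))` under the product
measure with mean `x`; so the vectors of each given mean contribute at most `1`. -/
lemma sum_exp_neg_binEntropy_le {n : ℕ} (hn : 0 < n) :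
    ∑ ρ : Fin n → ℤˣ, Real.exp (-(n * Real.binEntropy ((1 + signMean ρ) / 2))) ≤ n + 1 := by
  have hn' : (0 : ℝ) < n := by exact_mod_cast hn
  set pos : (Fin n → ℤˣ) → ℕ := fun ρ => (Finset.univ.filter fun i => ρ i = 1).card with hpos
  have hle : ∀ ρ, pos ρ ≤ n := fun ρ => by
    simpa using Finset.card_le_univ (Finset.univ.filter fun i => ρ i = 1)
  have hneg : ∀ ρ : Fin n → ℤˣ, (Finset.univ.filter fun i => ¬ρ i = 1).card = n - pos ρ :=
    fun ρ => by
      have := Finset.card_filter_add_card_filter_not (s := Finset.univ) fun i : Fin n => ρ i = 1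
      simp only [Finset.card_univ, Fintype.card_fin] at this
      simp only [hpos]
      omega
  have hmean : ∀ ρ : Fin n → ℤˣ, (1 + signMean ρ) / 2 = (pos ρ : ℝ) / n := by
    intro ρ
    have h1 : ∀ i, (((ρ i : ℤˣ) : ℤ) : ℝ) = 2 * (if ρ i = 1 then 1 else 0) - 1 := fun i => by
      rcases Int.units_eq_one_or (ρ i) with h | h
      · simp [h]; norm_num
      · rw [h, if_neg (by decide)]; norm_num
    rw [signMean, Fintype.expect_eq_sum_div_card]
    simp only [h1]
    rw [Finset.sum_sub_distrib, ← Finset.mul_sum, Finset.sum_boole]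
    simp only [Finset.sum_const, Finset.card_univ, Fintype.card_fin, hpos]
    field_simp
    simp
  set r : ℕ → ℤˣ → ℝ := fun z s => if s = 1 then (z : ℝ) / n else 1 - (z : ℝ) / n with hr
  have hr0 : ∀ z, z ≤ n → ∀ s, 0 ≤ r z s := fun z hz s => by
    have : (z : ℝ) / n ≤ 1 := by rw [div_le_one hn']; exact_mod_cast hz
    simp only [hr]
    split_ifs
    · positivity
    · linarith
  have hterm : ∀ ρ, Real.exp (-(n * Real.binEntropy ((1 + signMean ρ) / 2))) =
      ∏ i, r (pos ρ) (ρ i) := fun ρ => by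
    rw [hmean, ← pow_mul_pow_eq_exp_binEntropy hn (hle ρ)]
    simp only [hr]
    rw [Finset.prod_ite, Finset.prod_const, Finset.prod_const, hneg]
  have hone : ∀ z, ∑ ρ : Fin n → ℤˣ, ∏ i, r z (ρ i) = 1 := fun z => by
    rw [← Fintype.prod_sum fun (_ : Fin n) s => r z s, sum_intUnits]
    have : r z 1 + r z (-1) = 1 := by
      simp only [hr, if_true]
      rw [if_neg (by decide)]
      ring
    simp [this]
  calc _ = ∑ ρ, ∏ i, r (pos ρ) (ρ i) := Finset.sum_congr rfl fun ρ _ => hterm ρ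
    _ = ∑ z ∈ Finset.range (n + 1), ∑ ρ ∈ Finset.univ.filter (fun ρ => pos ρ = z),
          ∏ i, r (pos ρ) (ρ i) :=
        (Finset.sum_fiberwise_of_maps_to
          (fun ρ _ => Finset.mem_range.2 (Nat.lt_succ_of_le (hle ρ))) _).symm
    _ ≤ ∑ z ∈ Finset.range (n + 1), (1 : ℝ) := by
        refine Finset.sum_le_sum fun z hz => ?_
        have hz' : z ≤ n := Nat.lt_succ_iff.1 (Finset.mem_range.1 hz)
        rw [← hone z]
        calc _ = ∑ ρ ∈ Finset.univ.filter (fun ρ => pos ρ = z), ∏ i, r z (ρ i) :=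
              Finset.sum_congr rfl fun ρ hρ => by rw [(Finset.mem_filter.1 hρ).2]
          _ ≤ _ := Finset.sum_le_sum_of_subset_of_nonneg (Finset.filter_subset _ _)
              fun ρ _ _ => Finset.prod_nonneg fun i _ => hr0 z hz' _
    _ = n + 1 := by simp

/-! ### The overlap exponent -/

/-- Expanded in powers of `x`, the overlap function has nonnegative coefficients and no linear
term. -/
lemma overlapFun_le {k : ℕ} (hk : 1 ≤ k) {δ x : ℝ} (h0 : 0 ≤ δ) (h1 : δ ≤ 1) :
    overlapFun k δ x ≤ (1 - δ) ^ 2 + δ ^ 2 * ((1 + |x|) ^ k - 1 - k * |x|) := by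
  obtain ⟨k, rfl⟩ : ∃ l, k = l + 1 := ⟨k - 1, by omega⟩
  have hexp : ∀ y : ℝ, (1 + y) ^ (k + 1) =
      ∑ j ∈ Finset.range (k + 1 + 1), y ^ j * ((k + 1).choose j : ℝ) := fun y => by
    rw [add_comm, add_pow]; simp
  have h2 : overlapFun (k + 1) δ x =
      ∑ j ∈ Finset.range (k + 1 + 1), x ^ j * ((k + 1).choose j : ℝ) * (δ ^ j - δ) ^ 2 := by
    rw [overlapFun, hexp, hexp, hexp, Finset.mul_sum, Finset.mul_sum, ← Finset.sum_sub_distrib,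
      ← Finset.sum_add_distrib]
    refine Finset.sum_congr rfl fun j _ => ?_
    rw [mul_pow, mul_pow, ← pow_mul, mul_comm 2 j, pow_mul]
    ring
  rw [h2, hexp, Finset.sum_range_succ', Finset.sum_range_succ', Finset.sum_range_succ',
    Finset.sum_range_succ']
  have hterm : ∑ j ∈ Finset.range k,
        x ^ (j + 1 + 1) * ((k + 1).choose (j + 1 + 1) : ℝ) * (δ ^ (j + 1 + 1) - δ) ^ 2 ≤
      δ ^ 2 * ∑ j ∈ Finset.range k, |x| ^ (j + 1 + 1) * ((k + 1).choose (j + 1 + 1) : ℝ) := by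
    rw [Finset.mul_sum]
    refine Finset.sum_le_sum fun j _ => ?_
    have hp : δ ^ (j + 1 + 1) ≤ δ := pow_le_of_le_one h0 h1 (by omega)
    have hp0 : 0 ≤ δ ^ (j + 1 + 1) := by positivity
    have hsq : (δ ^ (j + 1 + 1) - δ) ^ 2 ≤ δ ^ 2 := by nlinarith
    have hx : x ^ (j + 1 + 1) ≤ |x| ^ (j + 1 + 1) := by
      rw [← abs_pow]; exact le_abs_self _
    calc _ ≤ |x| ^ (j + 1 + 1) * ((k + 1).choose (j + 1 + 1) : ℝ) * (δ ^ (j + 1 + 1) - δ) ^ 2 := by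
          gcongr
      _ ≤ |x| ^ (j + 1 + 1) * ((k + 1).choose (j + 1 + 1) : ℝ) * δ ^ 2 := by gcongr
      _ = _ := by ring
  simp only [zero_add, pow_zero, pow_one, Nat.choose_zero_right, Nat.choose_one_right,
    Nat.cast_one, sub_self]
  push_cast at *
  linarith

/-- The tangent line, of slope `K`, to the concave function `ε * log (1 / ε) + ε ≥ H ε`. -/
lemma binEntropy_le_mul_add_exp {ε : ℝ} (h0 : 0 ≤ ε) (h1 : ε < 1) (K : ℝ) :
    Real.binEntropy ε ≤ ε * K + Real.exp (-K) := by
  rcases h0.eq_or_lt with rfl | hpos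
  · simpa using (Real.exp_pos _).le
  have h1' : 0 < 1 - ε := by linarith
  have a1 := Real.log_le_sub_one_of_pos (div_pos (Real.exp_pos (-K)) hpos)
  rw [Real.log_div (Real.exp_pos _).ne' hpos.ne', Real.log_exp] at a1
  have a2 := Real.log_le_sub_one_of_pos (inv_pos.2 h1')
  rw [Real.binEntropy, Real.log_inv ε]
  have b1 := mul_le_mul_of_nonneg_left a1 hpos.le
  have b2 := mul_le_mul_of_nonneg_left a2 h1'.le
  have e1 : ε * (Real.exp (-K) / ε - 1) = Real.exp (-K) - ε := by field_simp
  have e2 : (1 - ε) * ((1 - ε)⁻¹ - 1) = ε := by field_simp; ring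
  rw [e1] at b1
  rw [e2] at b2
  linarith

/-- Pinsker's inequality for a single sign, from Gibbs' inequality against the exponentially
tilted sign with parameter `x`. -/
lemma sq_div_two_le_log_two_sub_binEntropy {x : ℝ} (h0 : -1 < x) (h1 : x < 1) :
    x ^ 2 / 2 ≤ Real.log 2 - Real.binEntropy ((1 + x) / 2) := by
  have ha : 0 < (1 + x) / 2 := by linarith
  have hb : 0 < 1 - (1 + x) / 2 := by linarith
  have hc : 0 < Real.cosh x := Real.cosh_pos x
  have g1 := Real.log_le_sub_one_of_pos
    (div_pos (div_pos (Real.exp_pos x) (mul_pos two_pos hc)) ha)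
  have g2 := Real.log_le_sub_one_of_pos
    (div_pos (div_pos (Real.exp_pos (-x)) (mul_pos two_pos hc)) hb)
  rw [Real.log_div (by positivity) ha.ne', Real.log_div (by positivity) (by positivity),
    Real.log_exp] at g1
  rw [Real.log_div (by positivity) hb.ne', Real.log_div (by positivity) (by positivity),
    Real.log_exp] at g2
  have g1' := mul_le_mul_of_nonneg_left g1 ha.le
  have g2' := mul_le_mul_of_nonneg_left g2 hb.le
  have e1 : (1 + x) / 2 * (Real.exp x / (2 * Real.cosh x) / ((1 + x) / 2) - 1) =
      Real.exp x / (2 * Real.cosh x) - (1 + x) / 2 := by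
    have : 1 + x ≠ 0 := by linarith
    field_simp
  have e2 : (1 - (1 + x) / 2) * (Real.exp (-x) / (2 * Real.cosh x) / (1 - (1 + x) / 2) - 1) =
      Real.exp (-x) / (2 * Real.cosh x) - (1 - (1 + x) / 2) := by
    rw [mul_sub, mul_div_cancel₀ _ hb.ne', mul_one]
  have e3 : Real.exp x / (2 * Real.cosh x) + Real.exp (-x) / (2 * Real.cosh x) = 1 := by
    rw [← add_div, Real.cosh_eq]
    field_simp
  have hcosh : Real.log (2 * Real.cosh x) ≤ Real.log 2 + x ^ 2 / 2 := by
    rw [Real.log_mul two_ne_zero hc.ne']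
    have := Real.log_le_log hc (Real.cosh_le_exp_half_sq x)
    rw [Real.log_exp] at this
    linarith
  rw [Real.binEntropy, Real.log_inv, Real.log_inv]
  rw [e1] at g1'
  rw [e2] at g2'
  nlinarith

lemma one_add_pow_sub_le (k : ℕ) {x : ℝ} (hx : 0 ≤ x) :
    (1 + x) ^ k - 1 - k * x ≤ (k : ℝ) ^ 2 * x ^ 2 * (1 + x) ^ k := by
  induction k with
  | zero => simp
  | succ k ih =>
    have hp : 1 ≤ (1 + x) ^ (k + 1) := one_le_pow₀ (by linarith)
    have h1 := mul_le_mul_of_nonneg_left ih (by linarith : 0 ≤ 1 + x)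
    have hkx : 0 ≤ (k : ℝ) * x ^ 2 := by positivity
    have h2 := mul_le_mul_of_nonneg_left hp hkx
    have hx2 : 0 ≤ x ^ 2 * (1 + x) ^ (k + 1) := by positivity
    have hk2 : 0 ≤ (k : ℝ) * (x ^ 2 * (1 + x) ^ (k + 1)) := by positivity
    push_cast
    rw [pow_succ] at *
    nlinarith

lemma exp_neg_le_one_sub_half {y : ℝ} (h0 : 0 ≤ y) (h1 : y ≤ 1) : Real.exp (-y) ≤ 1 - y / 2 := by
  have h := convexOn_exp.2 (Set.mem_univ 0) (Set.mem_univ (-1))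
    (by linarith : 0 ≤ 1 - y) h0 (by ring)
  simp only [smul_eq_mul, mul_zero, mul_neg, mul_one, zero_add, Real.exp_zero] at h
  have h2 : Real.exp (-1) ≤ 1 / 2 := by
    have := Real.exp_neg_one_lt_d9
    linarith
  nlinarith

/-- Written in terms of `(1 + x) / 2 = 1 - ε`, the entropy gained by an overlap `x` never makes up
for the correlation of the clause weights. Very close to `ε = 0` the slack `4 / 2 ^ k` is what
pays for the entropy; for `ε ≥ 1 / 10` the absence of a linear term in the correlation does. -/
lemma correlation_add_binEntropy_le {k : ℕ} (hk : 12 ≤ k)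
    (ha : 2 * Real.log k + 1 ≤ k / 3) (hb : (k : ℝ) ^ 2 * (9 / 10) ^ k ≤ 1 / 2)
    {E ε : ℝ} (hE0 : 0 ≤ E) (hE : E ≤ Real.log 2 - 4 * (1 / 2) ^ k) (h0 : 0 ≤ ε)
    (h1 : ε ≤ 1 / 2) :
    E * ((1 - ε) ^ k - (1 / 2) ^ k * (1 + k * (1 - 2 * ε))) ≤
      Real.log 2 - Real.binEntropy (1 - ε) := by
  have hk' : (12 : ℝ) ≤ k := by exact_mod_cast hk
  have hu : (0 : ℝ) < (1 / 2) ^ k := by positivity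
  have hl1 := Real.log_two_gt_d9
  have hl2 := Real.log_two_lt_d9
  have hE2 : E ≤ Real.log 2 := by linarith
  have ha0 : 0 ≤ (1 - ε) ^ k := pow_nonneg (by linarith) k
  have hak : (1 - ε) ^ k ≤ Real.exp (-(k * ε)) := by
    have : (1 - ε) ≤ Real.exp (-ε) := by linarith [Real.add_one_le_exp (-ε)]
    calc (1 - ε) ^ k ≤ Real.exp (-ε) ^ k := pow_le_pow_left₀ (by linarith) this k
      _ = _ := by rw [← Real.exp_nat_mul]; congr 1; ring
  have hdrop : E * ((1 - ε) ^ k - (1 / 2) ^ k * (1 + k * (1 - 2 * ε))) ≤ E * (1 - ε) ^ k := by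
    refine mul_le_mul_of_nonneg_left ?_ hE0
    have : 0 ≤ (1 / 2 : ℝ) ^ k * (1 + k * (1 - 2 * ε)) := by
      have : 0 ≤ 1 - 2 * ε := by linarith
      positivity
    linarith
  by_cases hc1 : ε ≤ 1 / 10
  · rw [Real.binEntropy_one_sub]
    have hK := binEntropy_le_mul_add_exp h0 (by linarith : ε < 1)
    have hkε0 : 0 ≤ k * ε := by positivity
    refine hdrop.trans ?_
    by_cases hc2 : k * ε ≤ 1
    · by_cases hc3 : (k : ℝ) ^ 2 * ε ≤ 1
      -- With `K = log 2 * k * (1 - k * ε)`, `ε * K` is `log 2` times the deficit in the bound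
      -- `(1 - ε) ^ k ≤ 1 - k * ε * (1 - k * ε)`; only `exp (-K) ≤ 2 / 2 ^ k` is left to be paid for.
      · have hsmall : k * ε ≤ 1 / 2 := by nlinarith
        have hK' := hK (Real.log 2 * k * (1 - k * ε))
        have hexpK : Real.exp (-(Real.log 2 * k * (1 - k * ε))) ≤ 2 * (1 / 2) ^ k := by
          have e : -(Real.log 2 * k * (1 - k * ε)) =
              Real.log 2 * ((k : ℝ) ^ 2 * ε) + k * -Real.log 2 := by ring
          have e2 : Real.exp (k * -Real.log 2) = (1 / 2) ^ k := by
            rw [Real.exp_nat_mul, Real.exp_neg, Real.exp_log two_pos]; norm_num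
          rw [e, Real.exp_add, e2]
          refine mul_le_mul_of_nonneg_right ?_ hu.le
          calc _ ≤ Real.exp (Real.log 2) := Real.exp_le_exp.2 (by nlinarith)
            _ = 2 := Real.exp_log two_pos
        have hup : (1 - ε) ^ k ≤ 1 - k * ε + (k * ε) ^ 2 := by
          have h := (abs_le.1 (Real.abs_exp_sub_one_sub_id_le (x := -(k * ε))
            (by rw [abs_neg, abs_of_nonneg hkε0]; exact hc2))).2
          nlinarith
        have hlow : 1 / 2 ≤ (1 - ε) ^ k := by
          have := one_add_mul_le_pow (a := -ε) (by linarith) k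
          rw [← sub_eq_add_neg] at this
          linarith
        have s1 : E * (1 - ε) ^ k ≤ (Real.log 2 - 4 * (1 / 2) ^ k) * (1 - ε) ^ k :=
          mul_le_mul_of_nonneg_right hE ha0
        have s2 := mul_le_mul_of_nonneg_left hup (by linarith : 0 ≤ Real.log 2)
        have s3 := mul_le_mul_of_nonneg_left hlow hu.le
        nlinarith
      -- For `1 / k ^ 2 < ε ≤ 1 / k` the entropy is at most `ε * (2 * log k + 1)`.
      · push Not at hc3
        have hkpos : (0 : ℝ) < k := by linarith
        have hK' := hK (2 * Real.log k)
        have hexpK : Real.exp (-(2 * Real.log k)) ≤ ε := by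
          have : Real.exp (-(2 * Real.log k)) = ((k : ℝ) ^ 2)⁻¹ := by
            rw [Real.exp_neg, mul_comm, Real.exp_mul, Real.exp_log hkpos, Real.rpow_two]
          rw [this]
          exact (inv_le_iff_one_le_mul₀' (by positivity)).2 hc3.le
        have hhalf := hak.trans (exp_neg_le_one_sub_half hkε0 hc2)
        have s1 : E * (1 - ε) ^ k ≤ Real.log 2 * (1 - ε) ^ k :=
          mul_le_mul_of_nonneg_right hE2 ha0
        have s2 := mul_le_mul_of_nonneg_left hhalf (by linarith : 0 ≤ Real.log 2)
        have s3 := mul_le_mul_of_nonneg_left ha h0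
        have s4 : 2 / 3 * (k * ε) ≤ Real.log 2 * (k * ε) :=
          mul_le_mul_of_nonneg_right (by linarith) hkε0
        nlinarith
    · push Not at hc2
      have hK' := hK 2
      have hexp1 : Real.exp (-(k * ε)) ≤ Real.exp (-1) := Real.exp_le_exp.2 (by linarith)
      have he := Real.exp_neg_one_lt_d9
      have he2 : Real.exp (-2) ≤ 0.14 := by
        have : Real.exp (-2) = Real.exp (-1) * Real.exp (-1) := by
          rw [← Real.exp_add]; norm_num
        rw [this]
        nlinarith [Real.exp_pos (-1)]
      have s1 : E * (1 - ε) ^ k ≤ 0.7 * 0.37 := by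
        refine mul_le_mul (by linarith) (by linarith) ha0 (by norm_num)
      linarith
  · push Not at hc1
    have hx0 : 0 ≤ 1 - 2 * ε := by linarith
    have hx1 : 1 + (1 - 2 * ε) ≤ 9 / 5 := by linarith
    have hp := sq_div_two_le_log_two_sub_binEntropy (x := 1 - 2 * ε) (by linarith) (by linarith)
    have e1 : (1 + (1 - 2 * ε)) / 2 = 1 - ε := by ring
    rw [e1] at hp
    refine le_trans ?_ hp
    have ht := one_add_pow_sub_le k hx0
    have e2 : (1 - ε) ^ k - (1 / 2) ^ k * (1 + k * (1 - 2 * ε)) =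
        (1 / 2) ^ k * ((1 + (1 - 2 * ε)) ^ k - 1 - k * (1 - 2 * ε)) := by
      have : (1 - ε) ^ k = (1 / 2) ^ k * (1 + (1 - 2 * ε)) ^ k := by
        rw [← mul_pow]; congr 1; ring
      rw [this]; ring
    have hpow : (1 / 2 : ℝ) ^ k * (1 + (1 - 2 * ε)) ^ k ≤ (9 / 10) ^ k := by
      rw [← mul_pow]
      exact pow_le_pow_left₀ (by linarith) (by linarith) k
    have hbound : (1 - ε) ^ k - (1 / 2) ^ k * (1 + k * (1 - 2 * ε)) ≤ (1 - 2 * ε) ^ 2 / 2 := by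
      rw [e2]
      calc _ ≤ (1 / 2) ^ k * ((k : ℝ) ^ 2 * (1 - 2 * ε) ^ 2 * (1 + (1 - 2 * ε)) ^ k) := by gcongr
        _ = (k : ℝ) ^ 2 * (1 - 2 * ε) ^ 2 * ((1 / 2) ^ k * (1 + (1 - 2 * ε)) ^ k) := by ring
        _ ≤ (k : ℝ) ^ 2 * (1 - 2 * ε) ^ 2 * (9 / 10) ^ k := by gcongr
        _ = (1 - 2 * ε) ^ 2 * ((k : ℝ) ^ 2 * (9 / 10) ^ k) := by ring
        _ ≤ (1 - 2 * ε) ^ 2 * (1 / 2) := by gcongr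
        _ = _ := by ring
    calc _ ≤ E * ((1 - 2 * ε) ^ 2 / 2) := mul_le_mul_of_nonneg_left hbound hE0
      _ ≤ 1 * ((1 - 2 * ε) ^ 2 / 2) := by gcongr; linarith
      _ = _ := one_mul _

/-- At densities below `2 ^ k * log 2 - 10 * k` clauses per variable, the correlation of the
clause weights stays below the entropy deficit at every overlap. -/
lemma overlap_exponent_le {k : ℕ} (hk : 12 ≤ k)
    (ha : 2 * Real.log k + 1 ≤ k / 3) (hb : (k : ℝ) ^ 2 * (9 / 10) ^ k ≤ 1 / 2)
    {δ D x : ℝ} (hδ0 : 0 < δ) (hδ : δ ≤ ((1 + δ) / 2) ^ k) (hδk : k * δ ≤ 1)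
    (hD0 : 0 ≤ D) (hD : D ≤ 2 ^ k * Real.log 2 - 10 * k) (h0 : 0 ≤ x) (h1 : x ≤ 1) :
    D * (δ ^ 2 / (1 - δ) ^ 2 * ((1 + x) ^ k - 1 - k * x)) ≤
      Real.log 2 - Real.binEntropy ((1 + x) / 2) := by
  have hk' : (12 : ℝ) ≤ k := by exact_mod_cast hk
  have hl1 := Real.log_two_gt_d9
  have hl2 := Real.log_two_lt_d9
  set u : ℝ := (1 / 2) ^ k with hu
  have hu0 : 0 < u := by positivity
  have hu2 : u * 2 ^ k = 1 := by rw [hu, ← mul_pow]; norm_num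
  have hδ12 : δ ≤ 1 / 12 := by nlinarith
  have hpow : (1 + δ) ^ k ≤ Real.exp (k * δ) := by
    rw [Real.exp_nat_mul]
    exact pow_le_pow_left₀ (by linarith) (by linarith [Real.add_one_le_exp δ]) k
  have hδu : δ ≤ u * Real.exp (k * δ) := by
    refine hδ.trans ?_
    have : ((1 + δ) / 2) ^ k = u * (1 + δ) ^ k := by rw [hu, ← mul_pow]; congr 1; ring
    rw [this]
    gcongr
  have hδ3 : δ ≤ 3 * u := by
    have h3 : Real.exp (k * δ) ≤ 3 := by
      have := Real.exp_one_lt_d9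
      have := Real.exp_le_exp.2 hδk
      linarith
    nlinarith
  have hinv : 1 / (1 - δ) ≤ Real.exp (2 * δ) := by
    rw [div_le_iff₀ (by linarith)]
    have := Real.add_one_le_exp (2 * δ)
    nlinarith
  have hratio : δ / (1 - δ) ≤ u * Real.exp ((k + 2) * δ) := by
    have e : (k + 2) * δ = k * δ + 2 * δ := by ring
    rw [e, Real.exp_add, ← mul_assoc, div_eq_mul_one_div]
    exact mul_le_mul hδu hinv (by have : 0 < 1 - δ := by linarith
                                  positivity) (by positivity)
  have hy : 2 * ((k + 2) * δ) ≤ 7 * k * u := by nlinarith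
  have hη : δ ^ 2 / (1 - δ) ^ 2 ≤ u ^ 2 * Real.exp (7 * k * u) := by
    rw [← div_pow]
    calc (δ / (1 - δ)) ^ 2 ≤ (u * Real.exp ((k + 2) * δ)) ^ 2 :=
          pow_le_pow_left₀ (div_nonneg hδ0.le (by linarith)) hratio 2
      _ = u ^ 2 * Real.exp (2 * ((k + 2) * δ)) := by
          rw [mul_pow, ← Real.exp_nat_mul]; norm_num
      _ ≤ _ := by gcongr
  set η := δ ^ 2 / (1 - δ) ^ 2 with hη'
  have hη0 : 0 ≤ η := by positivity
  set E := D * η * 2 ^ k with hE'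
  have hE0 : 0 ≤ E := by positivity
  have hDu : D * u ≤ Real.log 2 - 10 * k * u := by
    calc D * u ≤ (2 ^ k * Real.log 2 - 10 * k) * u := by gcongr
      _ = Real.log 2 * (u * 2 ^ k) - 10 * k * u := by ring
      _ = _ := by rw [hu2, mul_one]
  have hu8 : u ≤ 1 / 8 := by
    calc u ≤ (1 / 2) ^ 3 := pow_le_pow_of_le_one (by norm_num) (by norm_num) (by omega)
      _ = 1 / 8 := by norm_num
  have hE : E ≤ Real.log 2 - 4 * u := by
    have hE1 : E ≤ (D * u) * Real.exp (7 * k * u) := by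
      calc E ≤ D * (u ^ 2 * Real.exp (7 * k * u)) * 2 ^ k := by
            rw [hE']; gcongr
        _ = D * u * Real.exp (7 * k * u) * (u * 2 ^ k) := by ring
        _ = _ := by rw [hu2, mul_one]
    have hexp : (1 - 7 * k * u) * Real.exp (7 * k * u) ≤ 1 := by
      have := Real.add_one_le_exp (-(7 * k * u))
      have h := mul_le_mul_of_nonneg_right this (Real.exp_pos (7 * k * u)).le
      rw [← Real.exp_add] at h
      simp only [neg_add_cancel, Real.exp_zero] at h
      linarith
    have hku : 12 * u ≤ k * u := by gcongr
    have hfac : Real.log 2 - 10 * k * u ≤ (Real.log 2 - 4 * u) * (1 - 7 * k * u) := by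
      nlinarith [mul_nonneg hu0.le (by positivity : 0 ≤ k * u)]
    calc E ≤ (D * u) * Real.exp (7 * k * u) := hE1
      _ ≤ ((Real.log 2 - 4 * u) * (1 - 7 * k * u)) * Real.exp (7 * k * u) := by
          exact mul_le_mul_of_nonneg_right (hDu.trans hfac) (Real.exp_pos _).le
      _ = (Real.log 2 - 4 * u) * ((1 - 7 * k * u) * Real.exp (7 * k * u)) := by ring
      _ ≤ (Real.log 2 - 4 * u) * 1 := by
          refine mul_le_mul_of_nonneg_left hexp (by linarith)
      _ = _ := mul_one _
  have h := correlation_add_binEntropy_le hk ha hb hE0 hE (ε := (1 - x) / 2) (by linarith)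
    (by linarith)
  have e1 : 1 - (1 - x) / 2 = (1 + x) / 2 := by ring
  rw [e1] at h
  refine le_trans (le_of_eq ?_) h
  have e2 : ((1 + x) / 2) ^ k = u * (1 + x) ^ k := by rw [hu, ← mul_pow]; congr 1; ring
  rw [e2, ← hu, hE']
  have e3 : D * η * 2 ^ k * (u * (1 + x) ^ k - u * (1 + k * (1 - 2 * ((1 - x) / 2)))) =
      D * (η * ((1 + x) ^ k - 1 - k * x)) * (u * 2 ^ k) := by ring
  rw [e3, hu2, mul_one]

/-! ### The root of the balance equation -/

/-- The root of the balance equation lies within `1 / (2 * k)` of one half. -/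
lemma existsUnique_root {k : ℕ} (hk : 12 ≤ k) (hk2 : 3 * (k : ℝ) * (1 / 2) ^ k < 1) {c : ℝ}
    (hc0 : 0 < c) (hc1 : c < 1) :
    ∃ p ∈ Set.Ioo (0 : ℝ) 1, 1 - 2 * p - c * (1 - p) ^ k = 0 ∧
      (∀ q ∈ Set.Ioo (0 : ℝ) 1, 1 - 2 * q - c * (1 - q) ^ k = 0 → q = p) ∧
      k * (1 - 2 * p) ≤ 1 := by
  have hk' : (12 : ℝ) ≤ k := by exact_mod_cast hk
  have hkpos : (0 : ℝ) < k := by linarith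
  set g : ℝ → ℝ := fun p => 1 - 2 * p - c * (1 - p) ^ k with hg
  set p₀ : ℝ := (1 - 1 / k) / 2 with hp₀
  have hinv : 1 / (k : ℝ) ≤ 1 / 12 := one_div_le_one_div_of_le (by norm_num) hk'
  have hinv0 : 0 < 1 / (k : ℝ) := by positivity
  have hright : g (1 / 2) ≤ 0 := by
    have : 0 ≤ c * (1 - 1 / 2) ^ k := by positivity
    simp only [hg]; linarith
  have hleft : 0 ≤ g p₀ := by
    have e1 : 1 - p₀ = 1 / 2 * (1 + 1 / k) := by rw [hp₀]; ring
    have e2 : 1 - 2 * p₀ = 1 / k := by rw [hp₀]; ring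
    have h3 : (1 + 1 / (k : ℝ)) ^ k ≤ 3 := by
      calc (1 + 1 / (k : ℝ)) ^ k ≤ Real.exp (1 / k) ^ k :=
            pow_le_pow_left₀ (by positivity) (by linarith [Real.add_one_le_exp (1 / (k : ℝ))]) k
        _ = Real.exp 1 := by rw [← Real.exp_nat_mul]; congr 1; field_simp
        _ ≤ 3 := by linarith [Real.exp_one_lt_d9]
    have h4 : c * (1 - p₀) ^ k ≤ 1 / k := by
      rw [e1, mul_pow, le_div_iff₀ hkpos]
      have hu : (0 : ℝ) < (1 / 2) ^ k := by positivity
      have h0 : (0 : ℝ) ≤ (1 + 1 / (k : ℝ)) ^ k := by positivity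
      calc c * ((1 / 2) ^ k * (1 + 1 / (k : ℝ)) ^ k) * k
          ≤ 1 * ((1 / 2) ^ k * 3) * k := by gcongr
        _ ≤ 1 := by linarith
    simp only [hg]; linarith
  have hcont : ContinuousOn g (Set.Icc p₀ (1 / 2)) := by
    simp only [hg]; fun_prop
  obtain ⟨p, ⟨hp1, hp2⟩, hgp⟩ :=
    intermediate_value_Icc' (by rw [hp₀]; linarith : p₀ ≤ 1 / 2) hcont ⟨hright, hleft⟩
  have hp0 : 0 < p := lt_of_lt_of_le (by rw [hp₀]; linarith) hp1
  -- On the segment from `0` the concave left-hand side lies above its chord, whose value at `0`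
  -- is `1 - c > 0`; so no root is followed by another one.
  have huniq : ∀ r s : ℝ, 0 < r → r < s → s < 1 → g r = 0 → g s ≠ 0 := by
    intro r s hr hrs hs1 hgr hgs
    have hs : 0 < s := hr.trans hrs
    have h1 : 0 < 1 - r / s := by rw [sub_pos, div_lt_one hs]; exact hrs
    have hconv := (convexOn_pow k).2 (Set.mem_Ici.2 (by norm_num : (0 : ℝ) ≤ 1))
      (Set.mem_Ici.2 (by linarith : 0 ≤ 1 - s)) h1.le (by positivity : 0 ≤ r / s) (by ring)
    simp only [smul_eq_mul, one_pow, mul_one] at hconv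
    have e : 1 - r / s + r / s * (1 - s) = 1 - r := by field_simp; ring
    rw [e] at hconv
    have h2 := mul_le_mul_of_nonneg_left hconv hc0.le
    simp only [hg] at hgr hgs
    have e3 : c * (1 - r / s + r / s * (1 - s) ^ k) =
        c * (1 - r / s) + r / s * (c * (1 - s) ^ k) := by ring
    have e4 : c * (1 - s) ^ k = 1 - 2 * s := by linarith
    have e5 : r / s * (1 - 2 * s) = r / s - 2 * r := by field_simp
    rw [e3, e4, e5] at h2
    nlinarith
  refine ⟨p, ⟨hp0, by linarith⟩, hgp, fun q hq hgq => ?_, ?_⟩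
  · rcases lt_trichotomy q p with h | h | h
    · exact absurd hgp (huniq q p hq.1 h (by linarith) hgq)
    · exact h
    · exact absurd hgq (huniq p q hp0 h hq.2 hgp)
  · have : 1 - 2 * p ≤ 1 / k := by rw [hp₀] at hp1; linarith
    rwa [le_div_iff₀ hkpos, mul_comm] at this

/-! ### Removing the tilt -/

lemma clauseWeight_rpow {k : ℕ} (β : ℝ) {ω : ℤˣ → ℝ} (hω : ∀ s, 0 < ω s) {ε : ℝ} (hε : 0 < ε)
    (τ : Fin k → ℤˣ) :
    clauseWeight β (fun _ => 1) τ ^ (ε / (1 + ε)) *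
      clauseWeight β (fun s => ω s ^ (1 + ε)) τ ^ (1 / (1 + ε)) = clauseWeight β ω τ := by
  unfold clauseWeight
  have hB : 0 < (if ∃ j, τ j = 1 then 1 else Real.exp (-β)) := by
    split_ifs
    · exact one_pos
    · exact Real.exp_pos _
  set B := (if ∃ j, τ j = 1 then 1 else Real.exp (-β))
  have hP : 0 < ∏ j, ω (τ j) := Finset.prod_pos fun j _ => hω _
  rw [Real.finsetProd_rpow _ _ fun j _ => (hω _).le, Finset.prod_const_one, mul_one,
    Real.mul_rpow hB.le (Real.rpow_nonneg hP.le _), ← Real.rpow_mul hP.le, ← mul_assoc,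
    ← Real.rpow_add hB]
  have e1 : ε / (1 + ε) + 1 / (1 + ε) = 1 := by field_simp; ring
  have e2 : (1 + ε) * (1 / (1 + ε)) = 1 := by field_simp
  rw [e1, e2, Real.rpow_one, Real.rpow_one]

/-- The logarithm of the tilted partition function is convex in the exponent of the tilt; this
compares the exponents `0 < 1 < 1 + ε`. -/
lemma le_log_tiltedZ_one {k n m : ℕ} (β : ℝ) {ω : ℤˣ → ℝ} (hω : ∀ s, 0 < ω s) {ε : ℝ}
    (hε : 0 < ε) (Φ : Fin m → Clause k n) :
    (1 + ε) * Real.log (tiltedZ β ω Φ) - Real.log (tiltedZ β (fun s => ω s ^ (1 + ε)) Φ) ≤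
      ε * Real.log (tiltedZ β (fun _ => 1) Φ) := by
  have hω' : ∀ s, 0 < ω s ^ (1 + ε) := fun s => Real.rpow_pos_of_pos (hω s) _
  have h := log_sum_rpow_mul_rpow_le (Finset.univ_nonempty (α := Fin n → ℤˣ))
    (y := fun σ => ∏ i, clauseWeight β (fun _ => 1) ((Φ i).lit σ))
    (z := fun σ => ∏ i, clauseWeight β (fun s => ω s ^ (1 + ε)) ((Φ i).lit σ))
    (fun σ => Finset.prod_pos fun i _ => clauseWeight_pos β (fun _ => one_pos) _)
    (fun σ => Finset.prod_pos fun i _ => clauseWeight_pos β hω' _)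
    (a := ε / (1 + ε)) (b := 1 / (1 + ε)) (by positivity) (by positivity)
    (by field_simp; ring)
  have e : ∀ σ : Fin n → ℤˣ,
      (∏ i, clauseWeight β (fun _ => 1) ((Φ i).lit σ)) ^ (ε / (1 + ε)) *
        (∏ i, clauseWeight β (fun s => ω s ^ (1 + ε)) ((Φ i).lit σ)) ^ (1 / (1 + ε)) =
      ∏ i, clauseWeight β ω ((Φ i).lit σ) := fun σ => by
    rw [← Real.finsetProd_rpow _ _ fun i _ => (clauseWeight_pos β (fun _ => one_pos) _).le,
      ← Real.finsetProd_rpow _ _ fun i _ => (clauseWeight_pos β hω' _).le,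
      ← Finset.prod_mul_distrib]
    exact Finset.prod_congr rfl fun i _ => clauseWeight_rpow β hω hε _
  simp only [e] at h
  have h2 := mul_le_mul_of_nonneg_left h (by linarith : 0 ≤ 1 + ε)
  have e2 : (1 + ε) * (ε / (1 + ε) *
        Real.log (∑ σ, ∏ i, clauseWeight β (fun _ => 1) ((Φ i).lit σ)) + 1 / (1 + ε) *
        Real.log (∑ σ, ∏ i, clauseWeight β (fun s => ω s ^ (1 + ε)) ((Φ i).lit σ))) =
      ε * Real.log (∑ σ, ∏ i, clauseWeight β (fun _ => 1) ((Φ i).lit σ)) +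
        Real.log (∑ σ, ∏ i, clauseWeight β (fun s => ω s ^ (1 + ε)) ((Φ i).lit σ)) := by
    field_simp
  rw [e2] at h2
  unfold tiltedZ
  linarith

lemma expect_log_le_log_expect {Ω : Type*} [Fintype Ω] [Nonempty Ω] {X : Ω → ℝ}
    (hX : ∀ w, 0 < X w) : 𝔼 w, Real.log (X w) ≤ Real.log (𝔼 w, X w) := by
  have hE : 0 < 𝔼 w, X w := Finset.expect_pos (fun a _ => hX a) Finset.univ_nonempty
  have h : ∀ w, Real.log (X w) ≤ Real.log (𝔼 w, X w) + (X w / (𝔼 w, X w) - 1) := fun w => by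
    have := Real.log_le_sub_one_of_pos (div_pos (hX w) hE)
    rw [Real.log_div (hX w).ne' hE.ne'] at this
    linarith
  calc _ ≤ 𝔼 w, (Real.log (𝔼 w, X w) + (X w / (𝔼 w, X w) - 1)) :=
        Finset.expect_le_expect fun w _ => h w
    _ = _ := by
        rw [Finset.expect_add_distrib, Finset.expect_sub_distrib, ← Finset.expect_div,
          div_self hE.ne']
        simp

/-- The mean weight of a random clause whose literals carry the `s`-th power of the balanced
weights. -/
noncomputable def meanWeight (k : ℕ) (β δ s : ℝ) : ℝ :=
  (((1 - δ) ^ s + (1 + δ) ^ s) / 2) ^ k - (1 - Real.exp (-β)) * ((1 + δ) ^ s / 2) ^ k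

lemma expect_clauseWeight_rpow (k : ℕ) (β δ s : ℝ) :
    𝔼 τ : Fin k → ℤˣ, clauseWeight β (fun r => balancedWeight δ r ^ s) τ =
      meanWeight k β δ s := by
  rw [expect_clauseWeight]
  simp only [balancedWeight, if_true]
  rw [if_neg (by decide), meanWeight]

lemma meanWeight_one {k : ℕ} {β δ : ℝ}
    (hδ : δ = (1 - Real.exp (-β)) * ((1 + δ) / 2) ^ k) : meanWeight k β δ 1 = 1 - δ := by
  rw [meanWeight, Real.rpow_one, Real.rpow_one, ← hδ]
  have : (1 - δ + (1 + δ)) / 2 = 1 := by ring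
  rw [this, one_pow]

/-- Under the balanced weights true and false literals are equally likely, so both enter the
logarithmic derivative symmetrically. -/
lemma hasDerivAt_log_meanWeight {k : ℕ} (hk : 1 ≤ k) {β δ : ℝ} (h0 : 0 ≤ δ) (h1 : δ < 1)
    (hδ : δ = (1 - Real.exp (-β)) * ((1 + δ) / 2) ^ k) :
    HasDerivAt (fun s => Real.log (meanWeight k β δ s))
      (k / 2 * (Real.log (1 - δ) + Real.log (1 + δ))) 1 := by
  have ha : 0 < 1 - δ := by linarith
  have hb : 0 < 1 + δ := by linarith
  have da : HasDerivAt (fun s : ℝ => (1 - δ) ^ s) ((1 - δ) ^ (1 : ℝ) * Real.log (1 - δ)) 1 := by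
    simpa using (Real.hasStrictDerivAt_const_rpow ha 1).hasDerivAt
  have db : HasDerivAt (fun s : ℝ => (1 + δ) ^ s) ((1 + δ) ^ (1 : ℝ) * Real.log (1 + δ)) 1 := by
    simpa using (Real.hasStrictDerivAt_const_rpow hb 1).hasDerivAt
  have hd := ((((da.add db).div_const 2).pow k).sub
    (((db.div_const 2).pow k).const_mul (1 - Real.exp (-β)))).log
    (by
      have := meanWeight_one hδ
      simp only [meanWeight] at this
      simp only [Pi.add_apply, Pi.sub_apply, Pi.pow_apply]
      rw [this]; exact ha.ne')
  refine hd.congr_deriv ?_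
  have hm := meanWeight_one hδ
  simp only [meanWeight] at hm
  simp only [Pi.add_apply, Pi.sub_apply, Pi.pow_apply, hm]
  simp only [Real.rpow_one]
  have e1 : (1 - δ + (1 + δ)) / 2 = 1 := by ring
  have e2 : (1 - Real.exp (-β)) * (k * ((1 + δ) / 2) ^ (k - 1) *
      ((1 + δ) * Real.log (1 + δ) / 2)) = k * δ * Real.log (1 + δ) := by
    have : ((1 + δ) / 2) ^ k = ((1 + δ) / 2) ^ (k - 1) * ((1 + δ) / 2) := by
      rw [← pow_succ]; congr 1; omega
    rw [this] at hδ
    calc _ = k * ((1 - Real.exp (-β)) * (((1 + δ) / 2) ^ (k - 1) * ((1 + δ) / 2))) *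
          Real.log (1 + δ) := by ring
      _ = _ := by rw [← hδ]
  rw [e1, one_pow, e2, div_eq_iff ha.ne']
  ring

/-! ### The free energy at a fixed number of clauses -/

/-- The second moment of the balanced partition function exceeds the square of its mean at most by
the factor `(n ^ k / n.descFactorial k) ^ m * (n + 1)`. -/
lemma expect_tiltedZ_sq_le_sq {k n m : ℕ} (hk : 1 ≤ k) (h : k ≤ n) {β δ D : ℝ} (h0 : 0 ≤ δ)
    (h1 : δ < 1) (hδ : δ = (1 - Real.exp (-β)) * ((1 + δ) / 2) ^ k) (hm : (m : ℝ) ≤ D * n)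
    (hD : ∀ x : ℝ, 0 ≤ x → x ≤ 1 →
      D * (δ ^ 2 / (1 - δ) ^ 2 * ((1 + x) ^ k - 1 - k * x)) ≤
        Real.log 2 - Real.binEntropy ((1 + x) / 2)) :
    𝔼 Φ : Fin m → Clause k n, tiltedZ β (balancedWeight δ) Φ ^ 2 ≤
      (((n : ℝ) ^ k / (n.descFactorial k : ℝ)) ^ m * (n + 1)) *
        (𝔼 Φ : Fin m → Clause k n, tiltedZ β (balancedWeight δ) Φ) ^ 2 := by
  have hn : 0 < n := by omega
  have : NeZero n := ⟨hn.ne'⟩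
  have hδ1 : 0 < 1 - δ := by linarith
  have hmean : 𝔼 Φ : Fin m → Clause k n, tiltedZ β (balancedWeight δ) Φ =
      2 ^ n * (1 - δ) ^ m := by
    rw [expect_tiltedZ h, ← meanWeight_one hδ, ← expect_clauseWeight_rpow]
    simp only [Real.rpow_one]
  have hterm : ∀ ρ : Fin n → ℤˣ, overlapFun k δ (signMean ρ) ^ m ≤
      (1 - δ) ^ (2 * m) * (2 ^ n *
        Real.exp (-(n * Real.binEntropy ((1 + signMean ρ) / 2)))) := by
    intro ρ
    set x := signMean ρ with hx
    have hx1 : |x| ≤ 1 := by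
      refine (Finset.abs_expect_le _ _).trans ?_
      have : ∀ i, |(((ρ i : ℤˣ) : ℤ) : ℝ)| = 1 := fun i => by
        rcases Int.units_eq_one_or (ρ i) with h | h <;> simp [h]
      simp [this]
    have hov0 : 0 ≤ overlapFun k δ x := by
      rw [hx, ← expect_pairWeight hδ ρ]
      exact Finset.expect_nonneg fun v _ => pairWeight_nonneg β (balancedWeight_pos h0 h1) _
    set ψ := (1 + |x|) ^ k - 1 - k * |x| with hψ
    have hψ0 : 0 ≤ ψ := by
      have := one_add_mul_le_pow (a := |x|) (by linarith [abs_nonneg x]) k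
      linarith
    have hov : overlapFun k δ x ≤ (1 - δ) ^ 2 * Real.exp (δ ^ 2 / (1 - δ) ^ 2 * ψ) := by
      calc overlapFun k δ x ≤ (1 - δ) ^ 2 + δ ^ 2 * ψ := overlapFun_le hk h0 h1.le
        _ = (1 - δ) ^ 2 * (δ ^ 2 / (1 - δ) ^ 2 * ψ + 1) := by field_simp; ring
        _ ≤ _ := by gcongr; exact Real.add_one_le_exp _
    have hent : Real.binEntropy ((1 + |x|) / 2) = Real.binEntropy ((1 + x) / 2) := by
      rcases abs_choice x with h | h
      · rw [h]
      · rw [h, ← Real.binEntropy_one_sub]; congr 1; ring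
    have hexp : (m : ℝ) * (δ ^ 2 / (1 - δ) ^ 2 * ψ) ≤
        n * Real.log 2 + -(n * Real.binEntropy ((1 + x) / 2)) := by
      have a1 := hD |x| (abs_nonneg x) hx1
      have a2 : 0 ≤ δ ^ 2 / (1 - δ) ^ 2 * ψ := by positivity
      have a3 := mul_le_mul_of_nonneg_right hm a2
      have a4 := mul_le_mul_of_nonneg_left a1 (Nat.cast_nonneg n : (0 : ℝ) ≤ n)
      rw [hent] at a4
      linarith
    calc overlapFun k δ x ^ m ≤ ((1 - δ) ^ 2 * Real.exp (δ ^ 2 / (1 - δ) ^ 2 * ψ)) ^ m :=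
          pow_le_pow_left₀ hov0 hov m
      _ = (1 - δ) ^ (2 * m) * Real.exp (m * (δ ^ 2 / (1 - δ) ^ 2 * ψ)) := by
          rw [mul_pow, ← pow_mul, Real.exp_nat_mul]
      _ ≤ (1 - δ) ^ (2 * m) * Real.exp (n * Real.log 2 +
            -(n * Real.binEntropy ((1 + x) / 2))) := by gcongr
      _ = _ := by rw [Real.exp_add, Real.exp_nat_mul, Real.exp_log two_pos]
  calc _ ≤ 2 ^ n * ((n : ℝ) ^ k / (n.descFactorial k : ℝ)) ^ m *
          ∑ ρ : Fin n → ℤˣ, overlapFun k δ (signMean ρ) ^ m := expect_tiltedZ_sq_le h m hδ h0 h1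
    _ ≤ 2 ^ n * ((n : ℝ) ^ k / (n.descFactorial k : ℝ)) ^ m *
          ∑ ρ : Fin n → ℤˣ, (1 - δ) ^ (2 * m) * (2 ^ n *
            Real.exp (-(n * Real.binEntropy ((1 + signMean ρ) / 2)))) := by
        gcongr with ρ
        exact hterm ρ
    _ = 2 ^ n * ((n : ℝ) ^ k / (n.descFactorial k : ℝ)) ^ m * ((1 - δ) ^ (2 * m) * (2 ^ n *
          ∑ ρ : Fin n → ℤˣ, Real.exp (-(n * Real.binEntropy ((1 + signMean ρ) / 2))))) := by
        rw [← Finset.mul_sum, ← Finset.mul_sum]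
    _ ≤ 2 ^ n * ((n : ℝ) ^ k / (n.descFactorial k : ℝ)) ^ m * ((1 - δ) ^ (2 * m) * (2 ^ n *
          (n + 1))) := by
        gcongr
        exact sum_exp_neg_binEntropy_le hn
    _ = _ := by rw [hmean]; ring

/-- The mean of `log Z` over formulas with exactly `m` clauses. -/
noncomputable def meanLogZ (k n m : ℕ) (β : ℝ) : ℝ :=
  𝔼 Φ : Fin m → Clause k n, Real.log (tiltedZ β (fun _ => 1) Φ)

/-- A lower bound for the mean of `log Z` with explicit errors; the tilt exponent `1 + ε` and the
moment exponent `t` are free parameters, to be sent to `1` and `0` after `n` tends to infinity. -/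
lemma le_meanLogZ {k n m : ℕ} (hk : 1 ≤ k) (h : k ≤ n) {β δ D : ℝ} (h0 : 0 ≤ δ)
    (h1 : δ < 1) (hδ : δ = (1 - Real.exp (-β)) * ((1 + δ) / 2) ^ k) (hm : (m : ℝ) ≤ D * n)
    (hD : ∀ x : ℝ, 0 ≤ x → x ≤ 1 →
      D * (δ ^ 2 / (1 - δ) ^ 2 * ((1 + x) ^ k - 1 - k * x)) ≤
        Real.log 2 - Real.binEntropy ((1 + x) / 2))
    {c t ε : ℝ} (hε : 0 < ε) (ht : 0 < t) (ht1 : t < 1) (htc : t * c ≤ 1)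
    (hc : ∀ τ τ' : Fin k → ℤˣ, clauseWeight β (balancedWeight δ) τ ≤
      Real.exp c * clauseWeight β (balancedWeight δ) τ') :
    n * Real.log 2 + m * (Real.log (1 - δ) -
        (Real.log (meanWeight k β δ (1 + ε)) - Real.log (meanWeight k β δ 1)) / ε) -
      (1 + ε) / ε * (t * m * c ^ 2 +
        (m * Real.log ((n : ℝ) ^ k / (n.descFactorial k : ℝ)) + Real.log (n + 1)) / t) ≤
    meanLogZ k n m β := by
  have hne := nonempty_clause h
  have hω := balancedWeight_pos h0 h1
  have hω' : ∀ s, 0 < balancedWeight δ s ^ (1 + ε) := fun s => Real.rpow_pos_of_pos (hω s) _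
  have hδ1 : 0 < 1 - δ := by linarith
  have hdf : (0 : ℝ) < n.descFactorial k := by
    exact_mod_cast Nat.pos_of_ne_zero (by rw [Ne, Nat.descFactorial_eq_zero_iff_lt]; omega)
  set R := (n : ℝ) ^ k / (n.descFactorial k : ℝ) with hR
  have hR1 : 1 ≤ R := by
    rw [hR, one_le_div hdf]
    exact_mod_cast Nat.descFactorial_le_pow n k
  have hK : 1 ≤ R ^ m * (n + 1 : ℝ) :=
    one_le_mul_of_one_le_of_one_le (one_le_pow₀ hR1) (by linarith [(n.cast_nonneg : (0 : ℝ) ≤ n)])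
  have hlK : Real.log (R ^ m * (n + 1 : ℝ)) = m * Real.log R + Real.log (n + 1) := by
    rw [Real.log_mul (by positivity) (by positivity), Real.log_pow]
  have hmean1 : Real.log (𝔼 Φ : Fin m → Clause k n, tiltedZ β (balancedWeight δ) Φ) =
      n * Real.log 2 + m * Real.log (1 - δ) := by
    rw [expect_tiltedZ h, ← meanWeight_one hδ, ← expect_clauseWeight_rpow]
    simp only [Real.rpow_one]
    have hp : 0 < 𝔼 τ : Fin k → ℤˣ, clauseWeight β (fun r => balancedWeight δ r) τ :=
      Finset.expect_pos (fun τ _ => clauseWeight_pos β hω τ) Finset.univ_nonempty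
    rw [Real.log_mul (by positivity) (by positivity), Real.log_pow, Real.log_pow]
  have hmean2 : Real.log (𝔼 Φ : Fin m → Clause k n,
      tiltedZ β (fun s => balancedWeight δ s ^ (1 + ε)) Φ) =
      n * Real.log 2 + m * Real.log (meanWeight k β δ (1 + ε)) := by
    rw [expect_tiltedZ h, expect_clauseWeight_rpow]
    have hp : 0 < meanWeight k β δ (1 + ε) := by
      rw [← expect_clauseWeight_rpow]
      exact Finset.expect_pos (fun τ _ => clauseWeight_pos β hω' τ) Finset.univ_nonempty
    rw [Real.log_mul (by positivity) (by positivity), Real.log_pow, Real.log_pow]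
  have hconc := log_expect_le_expect_log (fun Φ : Fin m → Clause k n => tiltedZ_pos β hω Φ)
    ht ht1 htc hK (fun Φ Ψ i hij => abs_log_tiltedZ_sub_le hω hc Φ Ψ i hij)
    (expect_tiltedZ_sq_le_sq hk h h0 h1 hδ hm hD)
  have hjens := expect_log_le_log_expect
    (fun Φ : Fin m → Clause k n => tiltedZ_pos β hω' Φ)
  have hinterp : (1 + ε) * 𝔼 Φ : Fin m → Clause k n, Real.log (tiltedZ β (balancedWeight δ) Φ) -
      𝔼 Φ : Fin m → Clause k n,
        Real.log (tiltedZ β (fun s => balancedWeight δ s ^ (1 + ε)) Φ) ≤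
      ε * meanLogZ k n m β := by
    rw [meanLogZ, Finset.mul_expect, Finset.mul_expect, ← Finset.expect_sub_distrib]
    exact Finset.expect_le_expect fun Φ _ => le_log_tiltedZ_one β hω hε Φ
  rw [hmean1, hlK] at hconc
  rw [hmean2] at hjens
  have hconc' := mul_le_mul_of_nonneg_left hconc (by linarith : 0 ≤ 1 + ε)
  rw [meanWeight_one hδ]
  refine le_of_mul_le_mul_left ?_ hε
  set err := (m * Real.log R + Real.log (n + 1 : ℝ)) / t
  set l := Real.log (meanWeight k β δ (1 + ε))
  have hexpand : ε * (n * Real.log 2 + m * (Real.log (1 - δ) - (l - Real.log (1 - δ)) / ε) -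
      (1 + ε) / ε * (t * m * c ^ 2 + err)) =
      (1 + ε) * (n * Real.log 2 + m * Real.log (1 - δ)) - (n * Real.log 2 + m * l) -
        (1 + ε) * (t * m * c ^ 2 + err) := by
    field_simp
    ring
  rw [hexpand]
  linarith

lemma tendsto_log_pow_div_descFactorial (k : ℕ) :
    Tendsto (fun n : ℕ => Real.log ((n : ℝ) ^ k / (n.descFactorial k : ℝ))) atTop (nhds 0) := by
  have hne : ∀ᶠ n : ℕ in atTop, (n.descFactorial k : ℝ) ≠ 0 := by
    filter_upwards [eventually_ge_atTop k] with n hn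
    exact_mod_cast fun e => absurd (Nat.descFactorial_eq_zero_iff_lt.1 e) (by omega)
  have h := (Asymptotics.isEquivalent_iff_tendsto_one hne).1 (isEquivalent_descFactorial k).symm
  have h2 := ((Real.continuousAt_log one_ne_zero).tendsto).comp h
  rw [Real.log_one] at h2
  exact h2

lemma tendsto_log_add_one_div :
    Tendsto (fun n : ℕ => Real.log ((n : ℝ) + 1) / n) atTop (nhds 0) := by
  have h := (Real.isLittleO_log_id_atTop.tendsto_div_nhds_zero).comp
    (tendsto_natCast_atTop_atTop (R := ℝ)|>.atTop_add (tendsto_const_nhds (x := (1 : ℝ))))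
  have h2 : Tendsto (fun n : ℕ => ((n : ℝ) + 1) / n) atTop (nhds 1) := by
    have := (tendsto_const_nhds (x := (1 : ℝ))).add (tendsto_one_div_atTop_nhds_zero_nat (𝕜 := ℝ))
    rw [add_zero] at this
    refine this.congr' ?_
    filter_upwards [eventually_gt_atTop 0] with n hn
    have : (n : ℝ) ≠ 0 := by positivity
    field_simp
  have h3 := h.mul h2
  rw [zero_mul] at h3
  refine h3.congr' ?_
  filter_upwards [eventually_gt_atTop 0] with n hn
  have h4 : (n : ℝ) ≠ 0 := by positivity
  have h5 : (n : ℝ) + 1 ≠ 0 := by positivity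
  simp only [Function.comp, id]
  field_simp

/-- The first-moment exponent of the balanced partition function bounds the free energy at density
`D` from below. -/
lemma eventually_le_meanLogZ {k : ℕ} (hk : 1 ≤ k) {β δ D : ℝ} (h0 : 0 ≤ δ)
    (h1 : δ < 1) (hδ : δ = (1 - Real.exp (-β)) * ((1 + δ) / 2) ^ k) (hD0 : 0 ≤ D)
    (hD : ∀ x : ℝ, 0 ≤ x → x ≤ 1 →
      D * (δ ^ 2 / (1 - δ) ^ 2 * ((1 + x) ^ k - 1 - k * x)) ≤
        Real.log 2 - Real.binEntropy ((1 + x) / 2))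
    {L : ℝ} (hL : L < Real.log 2 + D * (Real.log (1 - δ) -
      k / 2 * (Real.log (1 - δ) + Real.log (1 + δ)))) :
    ∀ᶠ n : ℕ in atTop, L ≤ meanLogZ k n ⌊D * n⌋₊ β / n := by
  obtain ⟨c, hc0, hc⟩ := exists_clauseWeight_le k β (balancedWeight_pos h0 h1)
  set S : ℝ → ℝ := fun ε =>
    (Real.log (meanWeight k β δ (1 + ε)) - Real.log (meanWeight k β δ 1)) / ε with hS
  have hSlim : Tendsto S (nhdsWithin 0 (Set.Ioi 0))
      (nhds (k / 2 * (Real.log (1 - δ) + Real.log (1 + δ)))) := by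
    have h := (hasDerivAt_log_meanWeight hk h0 h1 hδ).tendsto_slope_zero_right
    refine h.congr fun ε => ?_
    rw [smul_eq_mul, hS, inv_mul_eq_div]
  have hlim1 : Tendsto (fun ε => Real.log 2 + D * (Real.log (1 - δ) - S ε))
      (nhdsWithin 0 (Set.Ioi 0)) (nhds (Real.log 2 + D * (Real.log (1 - δ) -
      k / 2 * (Real.log (1 - δ) + Real.log (1 + δ))))) :=
    ((hSlim.const_sub _).const_mul D).const_add _
  obtain ⟨ε, hε1, hε⟩ := ((hlim1.eventually_const_lt hL).and self_mem_nhdsWithin).exists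
  have hε : 0 < ε := hε
  have hlim2 : Tendsto (fun t : ℝ => Real.log 2 + D * (Real.log (1 - δ) - S ε) -
      (1 + ε) / ε * (t * D * c ^ 2)) (nhdsWithin 0 (Set.Ioi 0))
      (nhds (Real.log 2 + D * (Real.log (1 - δ) - S ε) - (1 + ε) / ε * (0 * D * c ^ 2))) := by
    refine Tendsto.mono_left (Continuous.tendsto ?_ 0) nhdsWithin_le_nhds
    fun_prop
  have ht_small : ∀ᶠ t : ℝ in nhdsWithin 0 (Set.Ioi 0), t < 1 ∧ t * c ≤ 1 := by
    have a1 : ∀ᶠ t : ℝ in nhds 0, t < 1 := eventually_lt_nhds one_pos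
    have a2 : ∀ᶠ t : ℝ in nhds 0, t < 1 / c := eventually_lt_nhds (by positivity)
    refine ((a1.and a2).filter_mono nhdsWithin_le_nhds).mono fun t h => ⟨h.1, ?_⟩
    exact ((lt_div_iff₀ hc0).1 h.2).le
  obtain ⟨t, ⟨ht2, ht1, htc⟩, ht⟩ := (((hlim2.eventually_const_lt
    (by simpa using hε1)).and ht_small).and self_mem_nhdsWithin).exists
  have ht : 0 < t := ht
  have hfloor : Tendsto (fun n : ℕ => ((⌊D * n⌋₊ : ℕ) : ℝ) / n) atTop (nhds D) :=
    (tendsto_nat_floor_mul_div_atTop hD0).comp tendsto_natCast_atTop_atTop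
  have hlim3 : Tendsto (fun n : ℕ => Real.log 2 + ((⌊D * n⌋₊ : ℕ) : ℝ) / n *
      (Real.log (1 - δ) - S ε) - (1 + ε) / ε * (t * (((⌊D * n⌋₊ : ℕ) : ℝ) / n) * c ^ 2 +
        (((⌊D * n⌋₊ : ℕ) : ℝ) / n * Real.log ((n : ℝ) ^ k / (n.descFactorial k : ℝ)) +
          Real.log ((n : ℝ) + 1) / n) / t)) atTop
      (nhds (Real.log 2 + D * (Real.log (1 - δ) - S ε) -
        (1 + ε) / ε * (t * D * c ^ 2 + (D * 0 + 0) / t))) := by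
    refine ((hfloor.mul_const _).const_add _).sub (Tendsto.const_mul _ ?_)
    refine ((hfloor.const_mul t).mul_const _).add (Tendsto.div_const ?_ t)
    exact (hfloor.mul (tendsto_log_pow_div_descFactorial k)).add tendsto_log_add_one_div
  filter_upwards [hlim3.eventually_const_lt (by simpa using ht2), eventually_ge_atTop k]
    with n hn hkn
  have hn0 : (0 : ℝ) < n := by exact_mod_cast (by omega : 0 < n)
  have hb := le_meanLogZ hk hkn h0 h1 hδ (m := ⌊D * n⌋₊)
    (Nat.floor_le (by positivity)) hD hε ht ht1 htc hc
  rw [le_div_iff₀ hn0]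
  refine le_trans (mul_le_mul_of_nonneg_right hn.le hn0.le) (le_trans (le_of_eq ?_) hb)
  simp only [hS]
  field_simp

/-! ### Changing the number of clauses -/

lemma tiltedZ_one_bounds {k n m : ℕ} {β : ℝ} (hβ : 0 ≤ β) (Φ : Fin m → Clause k n)
    (a : Clause k n) :
    Real.log (tiltedZ β (fun _ => 1) Φ) - β ≤
        Real.log (tiltedZ β (fun _ => 1) (Fin.cons a Φ : Fin (m + 1) → Clause k n)) ∧
      Real.log (tiltedZ β (fun _ => 1) (Fin.cons a Φ : Fin (m + 1) → Clause k n)) ≤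
        Real.log (tiltedZ β (fun _ => 1) Φ) := by
  have hpos : ∀ {m : ℕ} (Φ : Fin m → Clause k n), 0 < tiltedZ β (fun _ => 1) Φ :=
    fun Φ => tiltedZ_pos β (fun _ => one_pos) Φ
  have hw : ∀ τ : Fin k → ℤˣ, Real.exp (-β) ≤ clauseWeight β (fun _ => 1) τ ∧
      clauseWeight β (fun _ => 1) τ ≤ 1 := fun τ => by
    have : Real.exp (-β) ≤ 1 := Real.exp_le_one_iff.2 (by linarith)
    unfold clauseWeight
    split_ifs <;> simp [this]
  have hprod : ∀ σ : Fin n → ℤˣ, 0 ≤ ∏ i, clauseWeight β (fun _ => 1) ((Φ i).lit σ) := fun σ =>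
    Finset.prod_nonneg fun i _ => (clauseWeight_pos β (fun _ => one_pos) _).le
  have hcons : tiltedZ β (fun _ => 1) (Fin.cons a Φ : Fin (m + 1) → Clause k n) =
      ∑ σ, clauseWeight β (fun _ => 1) (a.lit σ) *
        ∏ i, clauseWeight β (fun _ => 1) ((Φ i).lit σ) := by
    unfold tiltedZ
    exact Finset.sum_congr rfl fun σ _ => by rw [Fin.prod_univ_succ]; simp
  constructor
  · have : Real.log (tiltedZ β (fun _ => 1) Φ) - β =
        Real.log (Real.exp (-β) * tiltedZ β (fun _ => 1) Φ) := by
      rw [Real.log_mul (Real.exp_pos _).ne' (hpos Φ).ne', Real.log_exp]; ring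
    rw [this]
    refine Real.log_le_log (mul_pos (Real.exp_pos _) (hpos Φ)) ?_
    rw [hcons, tiltedZ, Finset.mul_sum]
    exact Finset.sum_le_sum fun σ _ => mul_le_mul_of_nonneg_right (hw _).1 (hprod σ)
  · refine Real.log_le_log (hpos _) ?_
    rw [hcons, tiltedZ]
    exact Finset.sum_le_sum fun σ _ => mul_le_of_le_one_left (hprod σ) (hw _).2

lemma log_tiltedZ_one_bounds {k n : ℕ} {β : ℝ} (hβ : 0 ≤ β) :
    ∀ {m : ℕ} (Φ : Fin m → Clause k n),
      |Real.log (tiltedZ β (fun _ => 1) Φ)| ≤ n * Real.log 2 + β * m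
  | 0, Φ => by
    have hl : 0 ≤ n * Real.log 2 := by positivity
    simp [tiltedZ, abs_of_nonneg hl]
  | m + 1, Φ => by
    have ih := log_tiltedZ_one_bounds hβ (Fin.tail Φ)
    have h := tiltedZ_one_bounds hβ (Fin.tail Φ) (Φ 0)
    rw [Fin.cons_self_tail] at h
    rw [abs_le] at ih ⊢
    push_cast
    constructor <;> linarith

lemma meanLogZ_succ {k n : ℕ} (h : k ≤ n) (m : ℕ) {β : ℝ} (hβ : 0 ≤ β) :
    meanLogZ k n m β - β ≤ meanLogZ k n (m + 1) β ∧
      meanLogZ k n (m + 1) β ≤ meanLogZ k n m β := by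
  have := nonempty_clause h
  rw [meanLogZ, meanLogZ, expect_fin_cons]
  constructor
  · calc _ = 𝔼 _a : Clause k n, 𝔼 Φ : Fin m → Clause k n,
          (Real.log (tiltedZ β (fun _ => 1) Φ) - β) := by
          rw [Fintype.expect_const, Finset.expect_sub_distrib, Fintype.expect_const]
      _ ≤ _ := Finset.expect_le_expect fun a _ => Finset.expect_le_expect fun Φ _ =>
          (tiltedZ_one_bounds hβ Φ a).1
  · calc _ ≤ 𝔼 _a : Clause k n, 𝔼 Φ : Fin m → Clause k n,
          Real.log (tiltedZ β (fun _ => 1) Φ) :=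
          Finset.expect_le_expect fun a _ => Finset.expect_le_expect fun Φ _ =>
            (tiltedZ_one_bounds hβ Φ a).2
      _ = _ := Fintype.expect_const _

lemma meanLogZ_sub_le {k n : ℕ} (h : k ≤ n) {β : ℝ} (hβ : 0 ≤ β) (m N : ℕ) :
    meanLogZ k n m β - β * |(N : ℝ) - m| ≤ meanLogZ k n N β := by
  rcases le_total N m with hle | hle
  · have hanti : Antitone fun m => meanLogZ k n m β :=
      antitone_nat_of_succ_le fun m => (meanLogZ_succ h m hβ).2
    have := hanti hle
    have h0 : 0 ≤ β * |(N : ℝ) - m| := by positivity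
    simp only at this
    linarith
  · obtain ⟨j, rfl⟩ := Nat.exists_eq_add_of_le hle
    have hj : ∀ j : ℕ, meanLogZ k n m β - β * j ≤ meanLogZ k n (m + j) β := fun j => by
      induction j with
      | zero => simp
      | succ j ih =>
        have := (meanLogZ_succ h (m + j) hβ).1
        rw [← add_assoc]
        push_cast
        linarith
    have e : |((m + j : ℕ) : ℝ) - m| = j := by push_cast; simp
    rw [e]
    exact hj j

/-! ### Poisson moments -/

lemma hasSum_poisson_descFactorial (r : NNReal) (j : ℕ) :
    HasSum (fun n : ℕ => Real.exp (-r) * r ^ n / n.factorial * (n.descFactorial j : ℝ))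
      ((r : ℝ) ^ j) := by
  rw [← hasSum_nat_add_iff' j]
  have h0 : ∑ i ∈ Finset.range j,
      Real.exp (-r) * r ^ i / i.factorial * (i.descFactorial j : ℝ) = 0 :=
    Finset.sum_eq_zero fun i hi => by
      rw [Nat.descFactorial_eq_zero_iff_lt.2 (Finset.mem_range.1 hi)]; simp
  rw [h0, sub_zero]
  have h := (hasSum_one_poissonMeasure r).mul_left ((r : ℝ) ^ j)
  rw [mul_one] at h
  convert! h using 1
  funext n
  have hf : ((n.factorial : ℕ) : ℝ) * ((n + j).descFactorial j : ℝ) = (n + j).factorial := by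
    have := Nat.factorial_mul_descFactorial (Nat.le_add_left j n)
    rw [Nat.add_sub_cancel] at this
    exact_mod_cast this
  have h1 : ((n + j).factorial : ℝ) ≠ 0 := by positivity
  have h2 : (n.factorial : ℝ) ≠ 0 := by positivity
  rw [← mul_div_assoc, div_mul_eq_mul_div, div_eq_div_iff h1 h2, ← hf]
  ring

lemma integrable_natCast_poissonMeasure (r : NNReal) :
    Integrable (fun n : ℕ => (n : ℝ)) (poissonMeasure r) := by
  rw [integrable_poissonMeasure_iff]
  simpa using (hasSum_poisson_descFactorial r 1).summable

lemma integrable_abs_sub_poissonMeasure (r : NNReal) :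
    Integrable (fun n : ℕ => |(n : ℝ) - r|) (poissonMeasure r) :=
  ((integrable_natCast_poissonMeasure r).sub (integrable_const _)).abs

lemma integrable_sq_sub_poissonMeasure (r : NNReal) :
    Integrable (fun n : ℕ => ((n : ℝ) - r) ^ 2) (poissonMeasure r) ∧
      ∫ n : ℕ, ((n : ℝ) - r) ^ 2 ∂(poissonMeasure r) = r := by
  have h2 := hasSum_poisson_descFactorial r 2
  have h1 := (hasSum_poisson_descFactorial r 1).mul_left (1 - 2 * (r : ℝ))
  have h0 := (hasSum_poisson_descFactorial r 0).mul_left ((r : ℝ) ^ 2)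
  have h := (h2.add h1).add h0
  have e : (fun n : ℕ => Real.exp (-r) * r ^ n / n.factorial * (n.descFactorial 2 : ℝ) +
      (1 - 2 * (r : ℝ)) * (Real.exp (-r) * r ^ n / n.factorial * (n.descFactorial 1 : ℝ)) +
      (r : ℝ) ^ 2 * (Real.exp (-r) * r ^ n / n.factorial * (n.descFactorial 0 : ℝ))) =
      fun n : ℕ => Real.exp (-r) * r ^ n / n.factorial * ((n : ℝ) - r) ^ 2 := by
    funext n
    have : (n.descFactorial 2 : ℝ) = n ^ 2 - n := by
      rcases n with _ | n
      · simp
      · simp [Nat.descFactorial_succ]; ring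
    rw [this, Nat.descFactorial_one, Nat.descFactorial_zero]
    push_cast
    ring
  rw [e] at h
  have hv : (r : ℝ) ^ 2 + (1 - 2 * (r : ℝ)) * r ^ 1 + (r : ℝ) ^ 2 * r ^ 0 = r := by ring
  rw [hv] at h
  constructor
  · rw [integrable_poissonMeasure_iff]
    refine h.summable.congr fun n => ?_
    rw [Real.norm_of_nonneg (sq_nonneg _)]
  · rw [integral_poissonMeasure]
    exact h.tsum_eq

lemma integral_abs_sub_poissonMeasure_le (r : NNReal) (hr : 0 < r) :
    ∫ n : ℕ, |(n : ℝ) - r| ∂(poissonMeasure r) ≤ Real.sqrt r := by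
  obtain ⟨hi, hv⟩ := integrable_sq_sub_poissonMeasure r
  have hr' : (0 : ℝ) < r := hr
  have hs : 0 < Real.sqrt r := Real.sqrt_pos.2 hr'
  have hss : Real.sqrt r ^ 2 = r := Real.sq_sqrt hr'.le
  have hpt : ∀ n : ℕ, |(n : ℝ) - r| ≤ Real.sqrt r / 2 + ((n : ℝ) - r) ^ 2 / (2 * Real.sqrt r) := by
    intro n
    have h := sq_nonneg (|(n : ℝ) - r| - Real.sqrt r)
    have e : Real.sqrt r / 2 + ((n : ℝ) - r) ^ 2 / (2 * Real.sqrt r) =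
        (Real.sqrt r ^ 2 + |(n : ℝ) - r| ^ 2) / (2 * Real.sqrt r) := by
      rw [sq_abs]; field_simp
    rw [e, le_div_iff₀ (by positivity)]
    nlinarith
  have hi' : Integrable (fun n : ℕ => ((n : ℝ) - r) ^ 2 / (2 * Real.sqrt r))
      (poissonMeasure r) := hi.div_const _
  have hc : Integrable (fun _ : ℕ => Real.sqrt r / 2) (poissonMeasure r) := integrable_const _
  have hint : ∫ n : ℕ, (Real.sqrt r / 2 + ((n : ℝ) - r) ^ 2 / (2 * Real.sqrt r))
      ∂(poissonMeasure r) = Real.sqrt r := by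
    rw [integral_add hc hi', integral_div, integral_div, hv]
    simp only [integral_const, probReal_univ, one_smul]
    have e : (r : ℝ) / (2 * Real.sqrt r) = Real.sqrt r / 2 := by
      rw [div_eq_div_iff (by positivity) two_ne_zero]
      linarith
    rw [e]
    ring
  rw [← hint]
  exact integral_mono (integrable_abs_sub_poissonMeasure r) (hc.add hi') hpt

/-! ### The law of the random formula -/

instance (k n : ℕ) : DiscreteMeasurableSpace (Clause k n) := ⟨fun _ => trivial⟩

instance (k n : ℕ) : DiscreteMeasurableSpace (Formula k n) := ⟨fun _ => trivial⟩

instance (k n : ℕ) : Countable (Formula k n) := by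
  let f : Formula k n → Σ m, Fin m → Clause k n := fun Φ => ⟨Φ.size, Φ.clause⟩
  refine Function.Injective.countable (f := f) ?_
  rintro ⟨m, Φ⟩ ⟨m', Φ'⟩ h
  simp only [f, Sigma.mk.injEq] at h
  obtain ⟨rfl, h⟩ := h
  rw [eq_of_heq h]

lemma isProbabilityMeasure_clauseLaw {k n : ℕ} (h : k ≤ n) :
    IsProbabilityMeasure (clauseLaw k n) := by
  have := nonempty_clause h
  exact isProbabilityMeasure_uniformOn Set.finite_univ Set.univ_nonempty

lemma integral_pi_clauseLaw {k n : ℕ} (h : k ≤ n) (m : ℕ) (f : (Fin m → Clause k n) → ℝ) :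
    ∫ Φ, f Φ ∂(Measure.pi fun _ : Fin m => clauseLaw k n) = 𝔼 Φ, f Φ := by
  have := isProbabilityMeasure_clauseLaw h
  have := nonempty_clause h
  have hs : ∀ a : Clause k n, (clauseLaw k n).real {a} = 1 / Fintype.card (Clause k n) := by
    intro a
    rw [measureReal_def, clauseLaw, uniformOn_univ]
    simp
  rw [integral_fintype Integrable.of_finite, Fintype.expect_eq_sum_div_card, Finset.sum_div]
  refine Finset.sum_congr rfl fun Φ _ => ?_
  have : (Measure.pi fun _ : Fin m => clauseLaw k n).real {Φ} =
      ∏ i, (clauseLaw k n).real {Φ i} := by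
    rw [measureReal_def, Measure.pi_singleton, ENNReal.toReal_prod]
    rfl
  rw [this]
  simp only [hs, smul_eq_mul]
  simp
  field_simp

/-- The conditional law of the formula given the number of clauses. -/
noncomputable def formulaKernel (k n : ℕ) : Kernel ℕ (Formula k n) where
  toFun m := (Measure.pi fun _ : Fin m => clauseLaw k n).map (Formula.mk m)
  measurable' := measurable_from_top

lemma formulaLaw_eq (k n : ℕ) (d : ℝ) :
    formulaLaw k n d = (poissonMeasure (d * n / k).toNNReal).bind (formulaKernel k n) := rfl

lemma isMarkovKernel_formulaKernel {k n : ℕ} (h : k ≤ n) :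
    IsMarkovKernel (formulaKernel k n) := by
  have := isProbabilityMeasure_clauseLaw h
  exact ⟨fun m => Measure.isProbabilityMeasure_map (Measurable.of_discrete).aemeasurable⟩

lemma integral_formulaKernel {k n : ℕ} (h : k ≤ n) (m : ℕ) (f : Formula k n → ℝ) :
    ∫ Φ, f Φ ∂(formulaKernel k n m) = 𝔼 Φ : Fin m → Clause k n, f ⟨m, Φ⟩ := by
  rw [← integral_pi_clauseLaw h m fun Φ => f ⟨m, Φ⟩]
  exact integral_map (Measurable.of_discrete).aemeasurable
    (Measurable.of_discrete).aestronglyMeasurable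

lemma integrable_formulaKernel {k n : ℕ} (h : k ≤ n) (m : ℕ) (f : Formula k n → ℝ) :
    Integrable f (formulaKernel k n m) := by
  have := isProbabilityMeasure_clauseLaw h
  exact (integrable_map_measure (Measurable.of_discrete).aestronglyMeasurable
    (Measurable.of_discrete).aemeasurable).2 Integrable.of_finite

lemma integrable_log_Z {k n : ℕ} (h : k ≤ n) (d : ℝ) {β : ℝ} (hβ : 0 ≤ β) :
    Integrable (fun Φ : Formula k n => Real.log (Φ.Z β)) (formulaLaw k n d) := by
  have := isMarkovKernel_formulaKernel h
  have := nonempty_clause h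
  rw [formulaLaw_eq, Measure.integrable_comp_iff (Measurable.of_discrete).aestronglyMeasurable]
  refine ⟨Eventually.of_forall fun m => integrable_formulaKernel h m _, ?_⟩
  refine Integrable.mono' (g := fun m : ℕ => n * Real.log 2 + β * m)
    ((integrable_const _).add ((integrable_natCast_poissonMeasure _).const_mul β))
    (Measurable.of_discrete).aestronglyMeasurable (Eventually.of_forall fun m => ?_)
  rw [Real.norm_of_nonneg (integral_nonneg fun _ => norm_nonneg _), integral_formulaKernel h]
  calc _ ≤ 𝔼 _Φ : Fin m → Clause k n, (n * Real.log 2 + β * m) :=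
        Finset.expect_le_expect fun Φ _ => by
          rw [Formula.Z_eq_tiltedZ]; exact log_tiltedZ_one_bounds hβ Φ
    _ = _ := Fintype.expect_const _

lemma integral_log_Z {k n : ℕ} (h : k ≤ n) (d : ℝ) {β : ℝ} (hβ : 0 ≤ β) :
    Integrable (fun m => meanLogZ k n m β) (poissonMeasure (d * n / k).toNNReal) ∧
    ∫ Φ : Formula k n, Real.log (Φ.Z β) ∂(formulaLaw k n d) =
      ∫ m, meanLogZ k n m β ∂(poissonMeasure (d * n / k).toNNReal) := by
  have := isMarkovKernel_formulaKernel h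
  have := nonempty_clause h
  have hm : ∀ m, ∫ Φ : Formula k n, Real.log (Φ.Z β) ∂(formulaKernel k n m) =
      meanLogZ k n m β := fun m => by
    rw [integral_formulaKernel h, meanLogZ]
    exact Finset.expect_congr rfl fun Φ _ => by rw [Formula.Z_eq_tiltedZ]
  have hi := integrable_log_Z h d hβ
  rw [formulaLaw_eq] at hi ⊢
  refine ⟨?_, ?_⟩
  · refine Integrable.mono' (g := fun m : ℕ => n * Real.log 2 + β * m)
      ((integrable_const _).add ((integrable_natCast_poissonMeasure _).const_mul β))
      (Measurable.of_discrete).aestronglyMeasurable (Eventually.of_forall fun m => ?_)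
    refine (Finset.abs_expect_le _ _).trans ?_
    calc _ ≤ 𝔼 _Φ : Fin m → Clause k n, (n * Real.log 2 + β * m) :=
          Finset.expect_le_expect fun Φ _ => log_tiltedZ_one_bounds hβ Φ
      _ = _ := Fintype.expect_const _
  · rw [Measure.comp_eq_comp_const_apply] at hi ⊢
    rw [Kernel.integral_comp hi, Kernel.const_apply]
    simp only [hm]

/-- Replacing the Poisson number of clauses by its rounded mean costs `β` times its mean
deviation. -/
lemma meanLogZ_sub_le_integral_log_Z {k n : ℕ} (hk : 1 ≤ k) (h : k ≤ n) {d : ℝ} (hd : 0 < d)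
    {β : ℝ} (hβ : 0 ≤ β) :
    meanLogZ k n ⌊d / k * n⌋₊ β - β * (Real.sqrt (d / k * n) + 1) ≤
      ∫ Φ : Formula k n, Real.log (Φ.Z β) ∂(formulaLaw k n d) := by
  obtain ⟨hi, he⟩ := integral_log_Z h d hβ
  have hn0 : (0 : ℝ) < n := by exact_mod_cast (by omega : 0 < n)
  have hk0 : (0 : ℝ) < k := by exact_mod_cast (by omega : 0 < k)
  have hpos : 0 < d / k * n := by positivity
  have hdn : d * n / k = d / k * n := by ring
  rw [he]
  rw [hdn] at hi ⊢
  set r := (d / k * n).toNNReal with hr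
  have hr' : (r : ℝ) = d / k * n := Real.coe_toNNReal _ hpos.le
  have habs : Integrable (fun N : ℕ => |(N : ℝ) - r| + 1) (poissonMeasure r) :=
    (integrable_abs_sub_poissonMeasure r).add (integrable_const _)
  have hpt : ∀ N : ℕ, meanLogZ k n ⌊d / k * n⌋₊ β - β * (|(N : ℝ) - r| + 1) ≤
      meanLogZ k n N β := fun N => by
    refine le_trans ?_ (meanLogZ_sub_le h hβ ⌊d / k * n⌋₊ N)
    have h1 : |(r : ℝ) - (⌊d / k * n⌋₊ : ℕ)| ≤ 1 := by
      rw [hr', abs_le]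
      constructor
      · linarith [Nat.floor_le hpos.le]
      · linarith [Nat.lt_floor_add_one (d / k * n)]
    have h2 := abs_sub_le (N : ℝ) r (⌊d / k * n⌋₊ : ℕ)
    have h3 := mul_le_mul_of_nonneg_left (h2.trans (add_le_add_right h1 _)) hβ
    linarith
  have hint : Integrable (fun N : ℕ => meanLogZ k n ⌊d / k * n⌋₊ β - β * (|(N : ℝ) - r| + 1))
      (poissonMeasure r) :=
    (integrable_const _).sub (habs.const_mul β)
  have h := integral_mono hint hi hpt
  rw [integral_sub (integrable_const _) (habs.const_mul β), integral_const_mul,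
    integral_add (integrable_abs_sub_poissonMeasure r) (integrable_const _)] at h
  simp only [integral_const, probReal_univ, one_smul] at h
  have hs := integral_abs_sub_poissonMeasure_le r (by rw [hr]; exact Real.toNNReal_pos.2 hpos)
  rw [hr'] at hs h
  have hs' := mul_le_mul_of_nonneg_left (add_le_add_left hs 1) hβ
  linarith

lemma tendsto_sqrt_mul_add_one_div (a : ℝ) (ha : 0 ≤ a) (β : ℝ) :
    Tendsto (fun n : ℕ => β * (Real.sqrt (a * n) + 1) / n) atTop (nhds 0) := by
  have h1 : Tendsto (fun n : ℕ => (Real.sqrt n)⁻¹) atTop (nhds 0) :=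
    (Real.tendsto_sqrt_atTop.comp tendsto_natCast_atTop_atTop).inv_tendsto_atTop
  have h2 := tendsto_one_div_atTop_nhds_zero_nat (𝕜 := ℝ)
  have h3 := ((h1.const_mul (Real.sqrt a)).add h2).const_mul β
  rw [mul_zero, add_zero, mul_zero] at h3
  refine h3.congr fun n => ?_
  rcases Nat.eq_zero_or_pos n with rfl | hn
  · simp
  have hn' : (0 : ℝ) < n := by exact_mod_cast hn
  have hs : 0 < Real.sqrt n := Real.sqrt_pos.2 hn'
  have hss : Real.sqrt n * Real.sqrt n = n := Real.mul_self_sqrt hn'.le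
  rw [Real.sqrt_mul ha]
  have : (Real.sqrt n)⁻¹ = Real.sqrt n / n := by
    rw [inv_eq_one_div, div_eq_div_iff hs.ne' hn'.ne', one_mul, hss]
  rw [this]
  ring

/-- The conditions on `k` under which the overlap estimates and the location of the root hold. -/
lemma exists_forall_ge_large :
    ∃ k₀ : ℕ, 12 ≤ k₀ ∧ ∀ k : ℕ, k₀ ≤ k → 2 * Real.log k + 1 ≤ k / 3 ∧
      (k : ℝ) ^ 2 * (9 / 10) ^ k ≤ 1 / 2 ∧ 3 * (k : ℝ) * (1 / 2) ^ k < 1 := by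
  have h1 : ∀ᶠ k : ℕ in atTop, 2 * Real.log k + 1 ≤ (k : ℝ) / 3 := by
    have h := (Real.isLittleO_log_id_atTop.tendsto_div_nhds_zero).comp
      (tendsto_natCast_atTop_atTop (R := ℝ))
    have h' := (h.const_mul 2).add (tendsto_one_div_atTop_nhds_zero_nat (𝕜 := ℝ))
    rw [mul_zero, add_zero] at h'
    filter_upwards [h'.eventually_lt_const (by norm_num : (0 : ℝ) < 1 / 3),
      eventually_gt_atTop 0] with k hk hk0
    have hk0' : (0 : ℝ) < k := by exact_mod_cast hk0
    simp only [Function.comp, id] at hk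
    have e : 2 * (Real.log k / k) + 1 / k = (2 * Real.log k + 1) / k := by ring
    rw [e, div_lt_iff₀ hk0'] at hk
    linarith
  have h2 : ∀ᶠ k : ℕ in atTop, (k : ℝ) ^ 2 * (9 / 10) ^ k < 1 / 2 :=
    (tendsto_pow_const_mul_const_pow_of_abs_lt_one 2
      (by rw [abs_of_pos] <;> norm_num)).eventually_lt_const (by norm_num)
  have h3 : ∀ᶠ k : ℕ in atTop, (k : ℝ) ^ 1 * (1 / 2) ^ k < 1 / 3 :=
    (tendsto_pow_const_mul_const_pow_of_abs_lt_one 1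
      (by rw [abs_of_pos] <;> norm_num)).eventually_lt_const (by norm_num)
  obtain ⟨k₀, hk₀⟩ := eventually_atTop.1 (h1.and (h2.and h3))
  refine ⟨max 12 k₀, le_max_left _ _, fun k hk => ?_⟩
  obtain ⟨a, b, c⟩ := hk₀ k ((le_max_right _ _).trans hk)
  rw [pow_one] at c
  exact ⟨a, b.le, by linarith⟩

end RandomSAT

theorem proposition2p1 :
    ∃ k₀ : ℕ, 3 ≤ k₀ ∧ ∀ k : ℕ, k₀ ≤ k → ∀ β : ℝ, 1 ≤ β →
      ∀ d : ℝ, 0 < d → d < RandomSAT.dStar k →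
        ∃ p : ℝ, p ∈ Set.Ioo (0 : ℝ) 1 ∧
          1 - 2 * p - (1 - Real.exp (-β)) * (1 - p) ^ k = 0 ∧
          (∀ q ∈ Set.Ioo (0 : ℝ) 1,
            1 - 2 * q - (1 - Real.exp (-β)) * (1 - q) ^ k = 0 → q = p) ∧
          (∀ n : ℕ, k ≤ n →
            Integrable (fun Φ : RandomSAT.Formula k n => Real.log (Φ.Z β))
              (RandomSAT.formulaLaw k n d)) ∧
          (((1 - ((k : ℝ) - 1) * d / k) * Real.log 2 - d / 2 * Real.log p
              - d / 2 * Real.log (1 - p) + d / k * Real.log p : ℝ) : EReal) ≤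
            liminf (fun n : ℕ =>
              ((1 / (n : ℝ) * ∫ Φ : RandomSAT.Formula k n, Real.log (Φ.Z β)
                ∂(RandomSAT.formulaLaw k n d) : ℝ) : EReal)) atTop := by
  obtain ⟨k₀, hk₀, hlarge⟩ := RandomSAT.exists_forall_ge_large
  refine ⟨k₀, by omega, fun k hk β hβ d hd hdk => ?_⟩
  obtain ⟨ha, hb, hc⟩ := hlarge k hk
  have hk12 : 12 ≤ k := hk₀.trans hk
  have hk0 : (0 : ℝ) < k := by exact_mod_cast (by omega : 0 < k)
  have hβ0 : 0 ≤ β := by linarith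
  have hexp1 : Real.exp (-β) < 1 := by
    rw [Real.exp_lt_one_iff]; linarith
  have hexp0 := Real.exp_pos (-β)
  obtain ⟨p, ⟨hp0, hp1⟩, hroot, huniq, hpk⟩ := RandomSAT.existsUnique_root hk12 hc
    (c := 1 - Real.exp (-β)) (by linarith) (by linarith)
  refine ⟨p, ⟨hp0, hp1⟩, hroot, huniq, fun n hn => RandomSAT.integrable_log_Z hn d hβ0, ?_⟩
  set δ := 1 - 2 * p with hδdef
  have hq : 1 - p = (1 + δ) / 2 := by rw [hδdef]; ring
  have hδ : δ = (1 - Real.exp (-β)) * ((1 + δ) / 2) ^ k := by rw [← hq]; linarith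
  have hqk : 0 < ((1 + δ) / 2) ^ k := by rw [← hq]; exact pow_pos (by linarith) k
  have hδ0 : 0 < δ := by rw [hδ]; exact mul_pos (by linarith) hqk
  have hδ1 : δ < 1 := by rw [hδdef]; linarith
  have hδle : δ ≤ ((1 + δ) / 2) ^ k := by
    nlinarith
  have hD0 : 0 ≤ d / k := by positivity
  have hD : d / k ≤ 2 ^ k * Real.log 2 - 10 * k := by
    rw [div_le_iff₀ hk0]
    unfold RandomSAT.dStar at hdk
    nlinarith
  have hB : (1 - ((k : ℝ) - 1) * d / k) * Real.log 2 - d / 2 * Real.log p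
      - d / 2 * Real.log (1 - p) + d / k * Real.log p =
      Real.log 2 + d / k * (Real.log (1 - δ) -
        k / 2 * (Real.log (1 - δ) + Real.log (1 + δ))) := by
    have e1 : 1 - δ = 2 * p := by rw [hδdef]; ring
    have e2 : 1 + δ = 2 * (1 - p) := by rw [hδdef]; ring
    rw [e1, e2, Real.log_mul two_ne_zero hp0.ne', Real.log_mul two_ne_zero (by linarith)]
    field_simp
    ring
  rw [hB]
  refine EReal.ge_of_forall_gt_iff_ge.1 fun L hL => ?_
  have hL' := EReal.coe_lt_coe_iff.1 hL
  obtain ⟨L', hLL', hL'B⟩ := exists_between hL'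
  have hev := RandomSAT.eventually_le_meanLogZ (by omega) hδ0.le hδ1 hδ hD0
    (fun x h0 h1 => RandomSAT.overlap_exponent_le hk12 ha hb hδ0 hδle hpk hD0 hD h0 h1) hL'B
  refine le_liminf_of_le (by isBoundedDefault) ?_
  filter_upwards [hev, eventually_ge_atTop k,
    (RandomSAT.tendsto_sqrt_mul_add_one_div (d / k) hD0 β).eventually_lt_const
      (sub_pos.2 hLL')] with n hn hkn herr
  rw [EReal.coe_le_coe_iff]
  have hn0 : (0 : ℝ) < n := by exact_mod_cast (by omega : 0 < n)
  have h := div_le_div_of_nonneg_right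
    (RandomSAT.meanLogZ_sub_le_integral_log_Z (by omega) hkn hd hβ0) hn0.le
  rw [sub_div] at h
  rw [one_div, inv_mul_eq_div]
  linarith
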